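/- Let $F$ be a finite group with at least two elements and let $G=\mathbb Z^2\wr F$ be the (restricted) wreath product, that is, the semidirect product of $\mathbb Z^2$ and $\bigoplus_{\mathbb Z^2}F$, where $\mathbb Z^2$ acts by shifts. Let $S$ be a finite generating set of $G$ and let $l_S$ be the corresponding word length. Let $\mu$ be a probability measure on $G$ defining a standard switch-walk-switch random walk: $\mu=\mu_F*\mu_A*\mu_F$, where $\mu_F$ is the uniform distribution on the copy of $F$ at the origin of $\mathbb Z^2$ and $\mu_A$ is a symmetric probability measure on $\mathbb Z^2$. Let $\nu$ be the projection of $\mu$ to $\mathbb Z^2$, and assume that the support of $\nu$ consists of exactly five elements: the two standard generators of $\mathbb Z^2$, their inverses and the neutral element (in particular the walk is aperiodic). Let $r_{\rm cov}(n)=r_{\rm cov}(\nu,n)$ be any function, positive for all sufficiently large $n$, with the following property: for every $\epsilon>0$ there is $c>0$ such that for all sufficiently large $n$ the set of points of $\mathbb Z^2$ visited until the moment $n$ by the random walk $(\mathbb Z^2,\nu)$ started at the origin contains the ball of radius $c\,r_{\rm cov}(n)$ centred at the origin with probability at least $1-\epsilon$. Then the radius of individual almost invariance of $(G,\mu)$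 satisfies $\bar r(n)\succeq r_{\rm cov}(\nu,n)$. That is, for every function $r'(n)$ with $r'(n)/r_{\rm cov}(n)\to 0$ the walk $(G,\mu)$ has individually almost invariant distributions on the scale $r'(n)$: for every $\epsilon>0$, for all sufficiently large $n$ and all $g\in G$ with $l_S(g)\le r'(n)$, there is a subset $V\subset G$ (which may depend on $\epsilon$, $n$ and $g$) such that $\mu^{*n}(V)\ge 1-\epsilon$ and, for all $h\in V$, $\mu^{*n}(h)>0$ and $$\left|\frac{\mu^{*n}(hg)}{\mu^{*n}(h)}-1\right|\le\epsilon .$$ -/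

import Mathlib

open Filter Topology MeasureTheory
open scoped ENNReal

noncomputable section

/-! ### Restricted wreath products -/

/-- The direct sum of copies of `B` indexed by `A`: finitely supported functions `A → B`,
with pointwise multiplication. -/
def LampGroup (A B : Type*) [Group B] : Subgroup (A → B) where
  carrier := {f | (Function.mulSupport f).Finite}
  one_mem' := by simp
  mul_mem' {f g} hf hg := (Set.Finite.union hf hg).subset (Function.mulSupport_mul f g)
  inv_mem' {f} hf := by simpa using hf

theorem LampGroup.shift_finite {A B : Type*} [Group A] [Group B] (a : A) {f : A → B}
    (hf : (Function.mulSupport f).Finite) :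
    (Function.mulSupport fun x => f (a⁻¹ * x)).Finite :=
  hf.preimage (f := fun x => a⁻¹ * x) (mul_right_injective a⁻¹).injOn

/-- The action of `A` on the lamp group by shifts: `(a • f) x = f (a⁻¹ x)`. -/
def LampGroup.shift (A B : Type*) [Group A] [Group B] : A →* MulAut (LampGroup A B) where
  toFun a :=
    { toFun := fun f => ⟨fun x => f.1 (a⁻¹ * x), LampGroup.shift_finite a f.2⟩
      invFun := fun f => ⟨fun x => f.1 (a * x), by
        have h := LampGroup.shift_finite a⁻¹ f.2
        rwa [inv_inv] at h⟩
      left_inv := fun f => by ext x; simp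
      right_inv := fun f => by ext x; simp
      map_mul' := fun f g => rfl }
  map_one' := by ext f x; simp
  map_mul' a b := by ext f x; simp [mul_assoc]

/-- The (restricted) wreath product `A ≀ B`, the semidirect product of `A` and `⊕_A B`,
where `A` acts by shifts. -/
abbrev WreathProduct (A B : Type*) [Group A] [Group B] : Type _ :=
  SemidirectProduct (LampGroup A B) A (LampGroup.shift A B)

/-- The configuration with value `b` at the identity of `A` and trivial elsewhere. -/
def LampGroup.single (A : Type*) {B : Type*} [Group A] [Group B] (b : B) : LampGroup A B :=
  ⟨by classical exact Pi.mulSingle 1 b, by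
    classical
    exact (Set.finite_singleton (1 : A)).subset Pi.mulSupport_mulSingle_subset⟩

/-- The copy of `b ∈ B` in `A ≀ B` (supported at the identity of `A`). -/
def WreathProduct.lamp (A : Type*) {B : Type*} [Group A] [Group B] (b : B) :
    WreathProduct A B :=
  SemidirectProduct.inl (LampGroup.single A b)

/-! ### Random walks on groups -/

/-- Convolution of probability measures on a group: the law of the product of independent
elements. -/
def PMF.conv {G : Type*} [Group G] (μ κ : PMF G) : PMF G :=
  μ.bind fun a => κ.map fun b => a * b

/-- The `n`-fold convolution `μ^{*n}`. -/
def PMF.convPow {G : Type*} [Group G] (μ : PMF G) : ℕ → PMF G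
  | 0 => PMF.pure 1
  | n + 1 => (PMF.convPow μ n).conv μ

/-- The word length of `g` with respect to `S`: the least length of a word in `S ∪ S⁻¹`
representing `g` (used for generating sets `S`). -/
def wordLength {G : Type*} [Group G] (S : Set G) (g : G) : ℕ :=
  sInf {k | ∃ w : List G, (∀ s ∈ w, s ∈ S ∨ s⁻¹ ∈ S) ∧ w.prod = g ∧ w.length = k}

/-- The random walk `(G, μ)` has individually almost invariant distributions on the scale `r`:
for every `ε > 0`, every sufficiently large `n` and every `g` of length at most `r n`, there is
`V ⊆ G` (depending on `g`) with `μ^{*n}(V) ≥ 1 - ε` such that `|μ^{*n}(h g) / μ^{*n}(h) - 1| ≤ ε`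
for all `h ∈ V`. -/
def IsIndividuallyAlmostInvariant {G : Type*} [Group G] (S : Set G) (μ : PMF G)
    (r : ℕ → ℝ) : Prop :=
  ∀ ε : ℝ, 0 < ε → ∀ᶠ n : ℕ in atTop, ∀ g : G, (wordLength S g : ℝ) ≤ r n →
    ∃ V : Set G, 1 - ε ≤ ((μ.convPow n).toOuterMeasure V).toReal ∧
      ∀ h ∈ V, μ.convPow n h ≠ 0 ∧
        |(μ.convPow n (h * g)).toReal / (μ.convPow n h).toReal - 1| ≤ ε

/-- The radius of individual almost invariance of `(G, μ)` is asymptotically larger than `r`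
(written `r̄(n) ⪰ r(n)`): the walk has individually almost invariant distributions on every scale
`r'` with `r'(n) / r(n) → 0`. Meaningful for `r` eventually positive. -/
def IndividualRadiusGE {G : Type*} [Group G] (S : Set G) (μ : PMF G) (r : ℕ → ℝ) : Prop :=
  ∀ r' : ℕ → ℝ, Tendsto (fun n => r' n / r n) atTop (𝓝 0) →
    IsIndividuallyAlmostInvariant S μ r'

/-- `μ` defines a standard switch-walk-switch random walk on `A ≀ B`: `μ = μ_B * μ_A * μ_B`, where
`μ_A` is a symmetric measure on `A` and `μ_B` is the equidistribution on `B`. -/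
def IsStandardSwitchWalkSwitch {A B : Type*} [Group A] [Group B] [Fintype B]
    (μ : PMF (WreathProduct A B)) : Prop :=
  ∃ μA : PMF A, (∀ a, μA a⁻¹ = μA a) ∧
    μ = (((PMF.uniformOfFintype B).map (WreathProduct.lamp A)).conv
          (μA.map SemidirectProduct.inr)).conv
            ((PMF.uniformOfFintype B).map (WreathProduct.lamp A))

/-! ### Balls of `ℤ²` covered by a random walk -/

/-- The group `ℤ²`, written multiplicatively. -/
abbrev ZSq : Type := Multiplicative (ℤ × ℤ)

/-- The projection to `ℤ²` of a measure on `ℤ² ≀ F`. -/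
def projZSq {F : Type*} [Group F] (μ : PMF (WreathProduct ZSq F)) : PMF (ℤ × ℤ) :=
  μ.map fun g => g.right.toAdd

/-- The ball of radius `R` centred at the origin of `ℤ²`, for the word metric of the standard
generators. -/
def zsqBall (R : ℝ) : Set (ℤ × ℤ) := {z | ((|z.1| + |z.2| : ℤ) : ℝ) ≤ R}

/-- The points visited until the moment `n` by the walk started at the origin with increments
`ω 0, …, ω (n - 1)`; the position at time `k` is the sum of the first `k` increments. -/
def visited {n : ℕ} (ω : Fin n → ℤ × ℤ) : Set (ℤ × ℤ) :=
  {z | ∃ k ≤ n, ∑ i with (i : Fin n).val < k, ω i = z}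

/-- The probability that the first `n` steps of the random walk `(ℤ², ν)` visit every point of the
ball of radius `R` centred at the origin. -/
def coverProb (ν : PMF (ℤ × ℤ)) (n : ℕ) (R : ℝ) : ℝ :=
  (Measure.pi fun _ : Fin n => ν.toMeasure).real {ω | zsqBall R ⊆ visited ω}

/-- `r` is a covering radius `r_cov(ν, ·)`: for every `ε > 0` there is `c > 0` such that, for all
sufficiently large `n`, the set of points visited until the moment `n` contains the ball of radius
`c r(n)` with probability at least `1 - ε`. -/
def IsCoveringRadius (ν : PMF (ℤ × ℤ)) (r : ℕ → ℝ) : Prop :=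
  (∀ᶠ n in atTop, 0 < r n) ∧
    ∀ ε : ℝ, 0 < ε → ∃ c : ℝ, 0 < c ∧ ∀ᶠ n : ℕ in atTop, 1 - ε ≤ coverProb ν n (c * r n)

end

/-!
The law of the walk is invariant under inversion, so translating it by `g` on the right amounts to
starting the walk at `g` instead of at the identity. It therefore suffices to bound the total
variation distance between the laws at time `n` of these two walks; Markov's inequality then turns
this bound into closeness of the ratio of the two masses on a set of large mass
(`exists_set_ratio_le`). Total variation is measured by test functions with values in `[0, 1]`, on
which the walk acts by the Markov operator `swsAvg`.

Let `ρ` bound the position and the lamps of `g`; it is at most proportional to the word length.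
Let `m = K ρ²` with `K` a large constant.

* During the first `m` steps both walks stay, with high probability, in a square of side `O(ρ)`
  (`iterate_swsAvg_not_confined_le`, a maximal inequality obtained from the supersolution
  `(|x|² + k) / l²`), so only lamps in this square can be on.
* The lamps at sites visited during the remaining `n - m` steps are uniform and independent of the
  past. Hence the configuration at time `m` is forgotten unless those steps fail to cover the square
  (`abs_iterate_swsAvg_sub_le`), and only the position at time `m` matters.
* The positions of the two walks at time `m` are laws of the same walk on `ℤ²` with starting points
  at distance `O(ρ)`, and their total variation distance is `O(ρ / √m)` (`exists_gradient_bound`).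
  Indeed the variance of `u(X_m)` is at most `1` when `|u| ≤ 1`; it is a sum of `m` averaged
  one-step variances, each of which controls the squared gradient of the average of `u` over `m - 1`
  steps.

The hypothesis on the covering radius concerns coverings until time `n` rather than `n - m`. A set
which is covered until time `n` but not until time `n - m` is visited between these two times
(`missProb_le_add`). This is unlikely because `ρ` is negligible against `√n`: a covered ball has at
most `n + 1` points, and the gradient estimate shows that a square of side `o(√n)` carries little
mass at time `n - m` (`iterate_stepAvg_square_le`).
-/

/-! ### Averages over the steps of the walk on `ℤ²` -/

/-- The neutral element, the two standard generators of `ℤ²` and their inverses. -/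
def stepSet : Finset (ℤ × ℤ) := {(0, 0), (1, 0), (-1, 0), (0, 1), (0, -1)}

/-- The function `w` is the weight function of a symmetric probability measure on `ℤ²` whose
support is `stepSet`; its values outside `stepSet` play no role. -/
structure IsStepWeight (w : ℤ × ℤ → ℝ) : Prop where
  pos : ∀ s ∈ stepSet, 0 < w s
  symm : ∀ s, w (-s) = w s
  sum_eq_one : ∑ s ∈ stepSet, w s = 1

/-- The Markov operator of the random walk on `ℤ²` with step weights `w`. -/
noncomputable def stepAvg (w u : ℤ × ℤ → ℝ) (x : ℤ × ℤ) : ℝ := ∑ s ∈ stepSet, w s * u (x + s)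

theorem sum_stepSet (f : ℤ × ℤ → ℝ) :
    ∑ s ∈ stepSet, f s = f (0, 0) + f (1, 0) + f (-1, 0) + f (0, 1) + f (0, -1) := by
  rw [stepSet, Finset.sum_insert (by decide), Finset.sum_insert (by decide),
    Finset.sum_insert (by decide), Finset.sum_insert (by decide), Finset.sum_singleton]
  ring

section StepAvg

variable {w : ℤ × ℤ → ℝ} (hw : IsStepWeight w)
include hw

theorem IsStepWeight.nonneg {s : ℤ × ℤ} (hs : s ∈ stepSet) : 0 ≤ w s := (hw.pos s hs).le

theorem stepAvg_mono {u v : ℤ × ℤ → ℝ} (h : ∀ x, u x ≤ v x) (x : ℤ × ℤ) :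
    stepAvg w u x ≤ stepAvg w v x :=
  Finset.sum_le_sum fun _ hs => mul_le_mul_of_nonneg_left (h _) (hw.nonneg hs)

theorem stepAvg_const (c : ℝ) (x : ℤ × ℤ) : stepAvg w (fun _ => c) x = c := by
  rw [stepAvg, ← Finset.sum_mul, hw.sum_eq_one, one_mul]

theorem iterate_stepAvg_mono {u v : ℤ × ℤ → ℝ} (h : ∀ x, u x ≤ v x) (n : ℕ) (x : ℤ × ℤ) :
    (stepAvg w)^[n] u x ≤ (stepAvg w)^[n] v x := by
  induction n generalizing x with
  | zero => exact h x
  | succ n ih =>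
    rw [Function.iterate_succ_apply', Function.iterate_succ_apply']
    exact stepAvg_mono hw ih x

theorem iterate_stepAvg_const (c : ℝ) (n : ℕ) (x : ℤ × ℤ) :
    (stepAvg w)^[n] (fun _ => c) x = c := by
  induction n generalizing x with
  | zero => rfl
  | succ n ih =>
    rw [Function.iterate_succ_apply', funext ih]
    exact stepAvg_const hw c x

omit hw in
theorem iterate_stepAvg_add (u v : ℤ × ℤ → ℝ) (n : ℕ) (x : ℤ × ℤ) :
    (stepAvg w)^[n] (fun y => u y + v y) x = (stepAvg w)^[n] u x + (stepAvg w)^[n] v x := by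
  induction n generalizing x with
  | zero => rfl
  | succ n ih =>
    simp only [Function.iterate_succ_apply']
    rw [funext ih]
    simp [stepAvg, mul_add, Finset.sum_add_distrib]

omit hw in
theorem iterate_stepAvg_smul (c : ℝ) (u : ℤ × ℤ → ℝ) (n : ℕ) (x : ℤ × ℤ) :
    (stepAvg w)^[n] (fun y => c * u y) x = c * (stepAvg w)^[n] u x := by
  induction n generalizing x with
  | zero => rfl
  | succ n ih =>
    simp only [Function.iterate_succ_apply']
    rw [funext ih]
    simp only [stepAvg, Finset.mul_sum]
    exact Finset.sum_congr rfl fun _ _ => by ring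

omit hw in
theorem iterate_stepAvg_translate (u : ℤ × ℤ → ℝ) (y : ℤ × ℤ) (n : ℕ) (x : ℤ × ℤ) :
    (stepAvg w)^[n] (fun z => u (z + y)) x = (stepAvg w)^[n] u (x + y) := by
  induction n generalizing x with
  | zero => rfl
  | succ n ih =>
    simp only [Function.iterate_succ_apply']
    rw [funext ih]
    simp only [stepAvg]
    exact Finset.sum_congr rfl fun s _ => by rw [add_right_comm]

omit hw in
theorem iterate_stepAvg_sum {ι : Type*} (t : Finset ι) (u : ι → ℤ × ℤ → ℝ) (n : ℕ) (x : ℤ × ℤ) :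
    (stepAvg w)^[n] (fun y => ∑ i ∈ t, u i y) x = ∑ i ∈ t, (stepAvg w)^[n] (u i) x := by
  induction n generalizing x with
  | zero => rfl
  | succ n ih =>
    simp only [Function.iterate_succ_apply']
    rw [funext ih]
    simp only [stepAvg, Finset.mul_sum]
    exact Finset.sum_comm

/-! ### Gradient estimate -/

/-- The variance of one step of the walk dominates the squared increment of `u` along a step
`e`, because the steps `0` and `e` both have positive weight. -/
theorem stepAvg_sq_sub_sq_ge {e : ℤ × ℤ} (he : e ∈ stepSet) (he0 : e ≠ 0) {β : ℝ}
    (h0 : 2 * β ≤ w 0) (hβe : 2 * β ≤ w e) (hβ : 0 ≤ β) (u : ℤ × ℤ → ℝ) (x : ℤ × ℤ) :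
    β * (u (x + e) - u x) ^ 2 ≤ stepAvg w (fun y => u y ^ 2) x - stepAvg w u x ^ 2 := by
  set c := stepAvg w u x with hc
  have h1 : ∑ s ∈ stepSet, w s * (u (x + s) - c) ^ 2 =
      stepAvg w (fun y => u y ^ 2) x - c ^ 2 := by
    have : ∀ s ∈ stepSet, w s * (u (x + s) - c) ^ 2 =
        w s * u (x + s) ^ 2 - 2 * c * (w s * u (x + s)) + c ^ 2 * w s := fun s _ => by ring
    rw [Finset.sum_congr rfl this, Finset.sum_add_distrib, Finset.sum_sub_distrib,
      ← Finset.mul_sum, ← Finset.mul_sum, hw.sum_eq_one]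
    change stepAvg w (fun y => u y ^ 2) x - 2 * c * c + c ^ 2 * 1 = _
    ring
  have h2 : ∑ s ∈ ({0, e} : Finset (ℤ × ℤ)), w s * (u (x + s) - c) ^ 2 ≤
      ∑ s ∈ stepSet, w s * (u (x + s) - c) ^ 2 := by
    refine Finset.sum_le_sum_of_subset_of_nonneg ?_ fun s hs _ =>
      mul_nonneg (hw.nonneg hs) (sq_nonneg _)
    intro s hs
    rcases Finset.mem_insert.1 hs with rfl | hs
    · decide
    · rwa [Finset.mem_singleton.1 hs]
  rw [Finset.sum_pair he0.symm, add_zero] at h2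
  have h3 := mul_le_mul_of_nonneg_right h0 (sq_nonneg (u x - c))
  have h4 := mul_le_mul_of_nonneg_right hβe (sq_nonneg (u (x + e) - c))
  have h5 := mul_nonneg hβ (sq_nonneg ((u x - c) + (u (x + e) - c)))
  rw [← h1]
  nlinarith

theorem iterate_stepAvg_sq_le (u : ℤ × ℤ → ℝ) (n : ℕ) (x : ℤ × ℤ) :
    (stepAvg w)^[n] u x ^ 2 ≤ (stepAvg w)^[n] (fun y => u y ^ 2) x := by
  induction n generalizing x with
  | zero => rfl
  | succ n ih =>
    simp only [Function.iterate_succ_apply']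
    refine le_trans ?_ (stepAvg_mono hw ih x)
    have h := stepAvg_sq_sub_sq_ge hw (e := (1, 0)) (by decide) (by decide) (β := 0)
      (by simpa using hw.nonneg (s := 0) (by decide))
      (by simpa using hw.nonneg (s := (1, 0)) (by decide)) le_rfl ((stepAvg w)^[n] u) x
    linarith

/-- The variance of `u` after `n + 1` steps is the sum over the steps of the averaged one-step
variances; by Jensen's inequality and since increments commute with averaging, each of them is
at least `β` times the squared increment of the `n`-step average. -/
theorem gradient_sq_le_variance {e : ℤ × ℤ} (he : e ∈ stepSet) (he0 : e ≠ 0) {β : ℝ}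
    (h0 : 2 * β ≤ w 0) (hβe : 2 * β ≤ w e) (hβ : 0 ≤ β) (n : ℕ) (u : ℤ × ℤ → ℝ) (x : ℤ × ℤ) :
    (n + 1) * (β * ((stepAvg w)^[n] u (x + e) - (stepAvg w)^[n] u x) ^ 2) ≤
      (stepAvg w)^[n + 1] (fun y => u y ^ 2) x - (stepAvg w)^[n + 1] u x ^ 2 := by
  induction n generalizing u with
  | zero => simpa using stepAvg_sq_sub_sq_ge hw he he0 h0 hβe hβ u x
  | succ n ih =>
    have h1 := ih (stepAvg w u)
    have h2 : β * ((stepAvg w)^[n + 1] u (x + e) - (stepAvg w)^[n + 1] u x) ^ 2 ≤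
        (stepAvg w)^[n + 1] (fun y => β * (u (y + e) - u y) ^ 2) x := by
      rw [iterate_stepAvg_smul]
      refine mul_le_mul_of_nonneg_left ?_ hβ
      refine le_trans (le_of_eq ?_) (iterate_stepAvg_sq_le hw (fun y => u (y + e) - u y) (n + 1) x)
      have h3 := iterate_stepAvg_add (w := w) (fun y => u (y + e)) (fun y => (-1) * u y) (n + 1) x
      rw [iterate_stepAvg_smul, iterate_stepAvg_translate] at h3
      simp only [neg_mul, one_mul, ← sub_eq_add_neg] at h3
      rw [h3]
    have h3 := iterate_stepAvg_mono hw
      (fun y => stepAvg_sq_sub_sq_ge hw he he0 h0 hβe hβ u y) (n + 1) x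
    have h4 := iterate_stepAvg_add (w := w) (fun y => stepAvg w (fun z => u z ^ 2) y)
      (fun y => (-1) * stepAvg w u y ^ 2) (n + 1) x
    rw [iterate_stepAvg_smul] at h4
    simp only [neg_mul, one_mul, ← sub_eq_add_neg] at h4
    simp only [Function.iterate_succ_apply] at h1 h2 h3 h4 ⊢
    push_cast
    linarith

omit hw in
theorem abs_sub_le_mul_abs_of_unit_steps {v : ℤ → ℝ} {d : ℝ} (h : ∀ i, |v (i + 1) - v i| ≤ d)
    (i : ℤ) : |v i - v 0| ≤ d * |(i : ℝ)| := by
  induction i using Int.induction_on with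
  | zero => simp
  | succ i ih =>
    have h1 := abs_sub_le (v (i + 1)) (v i) (v 0)
    have h2 := h i
    have h3 : (0 : ℝ) ≤ i := i.cast_nonneg
    push_cast at ih ⊢
    rw [abs_of_nonneg h3] at ih
    rw [abs_of_nonneg (add_nonneg h3 zero_le_one)]
    linarith
  | pred i ih =>
    have h1 := abs_sub_le (v (-i - 1)) (v (-i)) (v 0)
    have h2 := h (-i - 1)
    rw [sub_add_cancel, abs_sub_comm] at h2
    have h3 : (0 : ℝ) ≤ i := i.cast_nonneg
    push_cast at ih ⊢
    have e1 : |(-(i : ℝ) - 1)| = i + 1 := by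
      rw [abs_of_nonpos (by linarith)]; ring
    rw [abs_neg, abs_of_nonneg h3] at ih
    rw [e1]
    linarith

/-- Averages of bounded functions over `n` steps of the walk have Lipschitz constant of order
`1 / √n`. -/
theorem exists_gradient_bound : ∃ D : ℝ, 0 < D ∧ ∀ u : ℤ × ℤ → ℝ, (∀ x, |u x| ≤ 1) →
    ∀ (n : ℕ) (x y : ℤ × ℤ), |(stepAvg w)^[n] u (x + y) - (stepAvg w)^[n] u x| ≤
      D / √(n + 1) * (|(y.1 : ℝ)| + |(y.2 : ℝ)|) := by
  obtain ⟨β, hβ, hβ0, hβ1, hβ2⟩ : ∃ β : ℝ, 0 < β ∧ 2 * β ≤ w 0 ∧ 2 * β ≤ w (1, 0) ∧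
      2 * β ≤ w (0, 1) := by
    have h0 := hw.pos 0 (by decide)
    have h1 := hw.pos (1, 0) (by decide)
    have h2 := hw.pos (0, 1) (by decide)
    refine ⟨min (w 0) (min (w (1, 0)) (w (0, 1))) / 2, by positivity, ?_, ?_, ?_⟩
    · linarith [min_le_left (w 0) (min (w (1, 0)) (w (0, 1)))]
    · linarith [min_le_right (w 0) (min (w (1, 0)) (w (0, 1))),
        min_le_left (w (1, 0)) (w (0, 1))]
    · linarith [min_le_right (w 0) (min (w (1, 0)) (w (0, 1))),
        min_le_right (w (1, 0)) (w (0, 1))]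
  refine ⟨1 / √β, by positivity, fun u hu n x y => ?_⟩
  have key : ∀ e ∈ stepSet, e ≠ 0 → 2 * β ≤ w e → ∀ z,
      |(stepAvg w)^[n] u (z + e) - (stepAvg w)^[n] u z| ≤ 1 / √β / √(n + 1) := by
    intro e he he0 hβe z
    have h1 := gradient_sq_le_variance hw he he0 hβ0 hβe hβ.le n u z
    have h2 : (stepAvg w)^[n + 1] (fun y => u y ^ 2) z ≤ 1 := by
      refine (iterate_stepAvg_mono hw (v := fun _ => 1) (fun y => ?_) _ _).trans_eq
        (iterate_stepAvg_const hw 1 _ _)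
      rw [← sq_abs]
      exact pow_le_one₀ (abs_nonneg _) (hu y)
    have h3 := sq_nonneg ((stepAvg w)^[n + 1] u z)
    have e : 1 / √β / √(n + 1) = √(1 / (β * (n + 1))) := by
      rw [Real.sqrt_div' _ (by positivity), Real.sqrt_one, Real.sqrt_mul hβ.le, div_div]
    rw [e]
    refine Real.abs_le_sqrt ?_
    rw [le_div_iff₀ (by positivity)]
    nlinarith
  have hx := abs_sub_le_mul_abs_of_unit_steps (v := fun i => (stepAvg w)^[n] u (x + (i, 0)))
    (fun i => by
      have := key (1, 0) (by decide) (by decide) hβ1 (x + (i, 0))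
      rwa [add_assoc, show ((i, 0) : ℤ × ℤ) + (1, 0) = (i + 1, 0) by simp] at this) y.1
  have hy := abs_sub_le_mul_abs_of_unit_steps
    (v := fun i => (stepAvg w)^[n] u (x + (y.1, 0) + (0, i)))
    (fun i => by
      have := key (0, 1) (by decide) (by decide) hβ2 (x + (y.1, 0) + (0, i))
      rwa [add_assoc (x + _), show ((0, i) : ℤ × ℤ) + (0, 1) = (0, i + 1) by simp] at this) y.2
  have e1 : x + (y.1, 0) + (0, y.2) = x + y := by ext <;> simp
  have e2 : x + (y.1, 0) + ((0, 0) : ℤ × ℤ) = x + (y.1, 0) := by ext <;> simp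
  have e3 : x + ((0, 0) : ℤ × ℤ) = x := by ext <;> simp
  simp only [e1, e2, e3] at hx hy
  have := abs_sub_le ((stepAvg w)^[n] u (x + y)) ((stepAvg w)^[n] u (x + (y.1, 0)))
    ((stepAvg w)^[n] u x)
  linarith

/-! ### Exit, hitting and covering probabilities of the walk on `ℤ²` -/

/-- The square of side `2 l` centred at the origin of `ℤ²`. -/
def square (l : ℕ) : Set (ℤ × ℤ) := {z | |z.1| ≤ l ∧ |z.2| ≤ l}

/-- The function `(|x - x₀|² + k) / l²` is a supersolution for the exit problem from a square,
`|·|` being the Euclidean norm. -/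
noncomputable def exitBound (x₀ : ℤ × ℤ) (l : ℝ) (k : ℕ) (x : ℤ × ℤ) : ℝ :=
  (((x.1 - x₀.1 : ℤ) : ℝ) ^ 2 + ((x.2 - x₀.2 : ℤ) : ℝ) ^ 2 + k) / l ^ 2

theorem stepAvg_exitBound_le (x₀ : ℤ × ℤ) (l : ℝ) (k : ℕ) (x : ℤ × ℤ) :
    stepAvg w (exitBound x₀ l k) x ≤ exitBound x₀ l (k + 1) x := by
  have hs := hw.sum_eq_one
  have h1 := hw.symm (1, 0)
  have h2 := hw.symm (0, 1)
  have h0 := hw.nonneg (s := (0, 0)) (by decide)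
  rw [sum_stepSet] at hs
  simp only [Prod.neg_mk, neg_zero] at h1 h2
  rw [h1, h2] at hs
  simp only [stepAvg, exitBound, sum_stepSet, ← mul_div_assoc, ← add_div, h1, h2, Prod.fst_add,
    Prod.snd_add]
  refine div_le_div_of_nonneg_right ?_ (sq_nonneg l)
  push_cast
  have e : w (0, 0) = 1 - 2 * w (1, 0) - 2 * w (0, 1) := by linarith
  rw [e] at h0 ⊢
  nlinarith

omit hw in
theorem exitBound_nonneg (x₀ : ℤ × ℤ) (l : ℝ) (k : ℕ) (x : ℤ × ℤ) :
    0 ≤ exitBound x₀ l k x := by unfold exitBound; positivity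

omit hw in
theorem one_le_exitBound {x₀ x : ℤ × ℤ} {l : ℕ} (hl : 0 < l) (k : ℕ) (h : x - x₀ ∉ square l) :
    1 ≤ exitBound x₀ l k x := by
  have hl' : (0 : ℝ) < l := by exact_mod_cast hl
  rw [exitBound, le_div_iff₀ (by positivity), one_mul]
  have hk : (0 : ℝ) ≤ k := k.cast_nonneg
  have aux : ∀ a : ℤ, (l : ℤ) < |a| → (l : ℝ) ^ 2 ≤ (a : ℝ) ^ 2 := fun a ha => by
    rw [← sq_abs (a : ℝ)]
    have : (l : ℝ) ≤ |(a : ℝ)| := by exact_mod_cast ha.le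
    gcongr
  by_cases h1 : |x.1 - x₀.1| ≤ l
  · have h2 : (l : ℤ) < |x.2 - x₀.2| := by
      by_contra h2
      exact h ⟨h1, not_lt.1 h2⟩
    nlinarith [aux _ h2, sq_nonneg ((x.1 - x₀.1 : ℤ) : ℝ)]
  · nlinarith [aux _ (not_le.1 h1), sq_nonneg ((x.2 - x₀.2 : ℤ) : ℝ)]

open Classical in
/-- The probability that the walk started at `x` visits the set `D` until the moment `k`. -/
noncomputable def hitProb (w : ℤ × ℤ → ℝ) (D : Set (ℤ × ℤ)) : ℕ → ℤ × ℤ → ℝ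
  | 0, x => if x ∈ D then 1 else 0
  | k + 1, x => if x ∈ D then 1 else stepAvg w (hitProb w D k) x

omit hw in
theorem hitProb_of_mem {D : Set (ℤ × ℤ)} {x : ℤ × ℤ} (h : x ∈ D) (k : ℕ) :
    hitProb w D k x = 1 := by cases k <;> simp [hitProb, h]

theorem hitProb_le_one (D : Set (ℤ × ℤ)) (k : ℕ) (x : ℤ × ℤ) : hitProb w D k x ≤ 1 := by
  induction k generalizing x with
  | zero => simp only [hitProb]; split_ifs <;> norm_num
  | succ k ih =>
    simp only [hitProb]
    split_ifs
    · rfl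
    · exact (stepAvg_mono hw ih x).trans_eq (stepAvg_const hw 1 x)

theorem hitProb_mono {D E : Set (ℤ × ℤ)} (h : D ⊆ E) (k : ℕ) (x : ℤ × ℤ) :
    hitProb w D k x ≤ hitProb w E k x := by
  induction k generalizing x with
  | zero =>
    simp only [hitProb]
    split_ifs with h1 h2 h2
    · rfl
    · exact absurd (h h1) h2
    · norm_num
    · rfl
  | succ k ih =>
    by_cases h1 : x ∈ E
    · rw [hitProb_of_mem h1]; exact hitProb_le_one hw D _ x
    · rw [hitProb, hitProb, if_neg h1, if_neg fun h2 => h1 (h h2)]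
      exact stepAvg_mono hw ih x

theorem hitProb_le_exitBound {D : Set (ℤ × ℤ)} {x₀ : ℤ × ℤ} {l : ℕ} (hl : 0 < l)
    (h : ∀ x ∈ D, x - x₀ ∉ square l) (k : ℕ) (x : ℤ × ℤ) :
    hitProb w D k x ≤ exitBound x₀ l k x := by
  induction k generalizing x with
  | zero =>
    by_cases hx : x ∈ D
    · rw [hitProb_of_mem hx]; exact one_le_exitBound hl _ (h x hx)
    · rw [hitProb, if_neg hx]; exact exitBound_nonneg _ _ _ _
  | succ k ih =>
    by_cases hx : x ∈ D
    · rw [hitProb_of_mem hx]; exact one_le_exitBound hl _ (h x hx)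
    · rw [hitProb, if_neg hx]
      exact (stepAvg_mono hw ih x).trans (stepAvg_exitBound_le hw _ _ _ _)

open Classical in
/-- The probability that the walk started at `x` does not cover the set `D` until the
moment `k`. -/
noncomputable def missProb (w : ℤ × ℤ → ℝ) : ℕ → Set (ℤ × ℤ) → ℤ × ℤ → ℝ
  | 0, D, x => if D ⊆ {x} then 0 else 1
  | k + 1, D, x => stepAvg w (missProb w k (D \ {x})) x

theorem missProb_nonneg (k : ℕ) (D : Set (ℤ × ℤ)) (x : ℤ × ℤ) : 0 ≤ missProb w k D x := by
  induction k generalizing x D with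
  | zero => simp only [missProb]; split_ifs <;> norm_num
  | succ k ih =>
    exact (stepAvg_const hw 0 x).symm.trans_le (stepAvg_mono hw (ih _) x)

theorem missProb_mono (k : ℕ) {D E : Set (ℤ × ℤ)} (h : D ⊆ E) (x : ℤ × ℤ) :
    missProb w k D x ≤ missProb w k E x := by
  induction k generalizing x D E with
  | zero =>
    simp only [missProb]
    split_ifs with h1 h2 h2
    · rfl
    · norm_num
    · exact absurd (h.trans h2) h1
    · rfl
  | succ k ih => exact stepAvg_mono hw (fun y => ih (Set.sdiff_subset_sdiff_left h) y) x

omit hw in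
theorem missProb_translate (k : ℕ) (D : Set (ℤ × ℤ)) (x y : ℤ × ℤ) :
    missProb w k ((fun z => z + y) ⁻¹' D) x = missProb w k D (x + y) := by
  induction k generalizing x D with
  | zero =>
    simp only [missProb]
    congr 1
    refine propext ⟨fun h z hz => ?_, fun h z hz => ?_⟩
    · have := h (show z - y ∈ (fun z => z + y) ⁻¹' D by simpa using hz)
      simpa [sub_eq_iff_eq_add] using this
    · simpa using h hz
  | succ k ih =>
    simp only [missProb, stepAvg]
    refine Finset.sum_congr rfl fun s _ => ?_
    rw [add_right_comm, ← ih]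
    congr 2
    ext z
    simp

theorem one_le_missProb_add_hitProb {D : Set (ℤ × ℤ)} (hD : D.Nonempty) (k : ℕ) (x : ℤ × ℤ) :
    1 ≤ missProb w k D x + hitProb w D k x := by
  induction k generalizing x with
  | zero =>
    by_cases hx : x ∈ D
    · rw [hitProb_of_mem hx]; linarith [missProb_nonneg hw 0 D x]
    · obtain ⟨d, hd⟩ := hD
      have : ¬ D ⊆ {x} := fun h => hx (h hd ▸ hd)
      simp [missProb, hitProb, hx, this]
  | succ k ih =>
    by_cases hx : x ∈ D
    · rw [hitProb_of_mem hx]; linarith [missProb_nonneg hw (k + 1) D x]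
    · rw [missProb, hitProb, if_neg hx, Set.sdiff_singleton_eq_self hx]
      have := iterate_stepAvg_add (w := w) (missProb w k D) (hitProb w D k) 1 x
      simp only [Function.iterate_one] at this
      rw [← this]
      exact (stepAvg_const hw 1 x).symm.trans_le (stepAvg_mono hw ih x)

/-- A set which is covered until the moment `k + m` but not until the moment `k` is visited
between these two moments. -/
theorem missProb_le_add (m k : ℕ) (D : Set (ℤ × ℤ)) (x : ℤ × ℤ) :
    missProb w k D x ≤ missProb w (k + m) D x + (stepAvg w)^[k] (hitProb w D m) x := by
  have hadd := fun u v x => iterate_stepAvg_add (w := w) u v 1 x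
  simp only [Function.iterate_one] at hadd
  induction k generalizing x D with
  | zero =>
    rw [zero_add, Function.iterate_zero, id]
    by_cases h : D ⊆ {x}
    · have h0 : 0 ≤ hitProb w D m x := by
        rw [← sub_nonneg]
        rcases D.eq_empty_or_nonempty with rfl | ⟨d, hd⟩
        · have : ∀ k y, hitProb w ∅ k y = 0 := by
            intro k
            induction k with
            | zero => simp [hitProb]
            | succ k ih => intro y; simp [hitProb, stepAvg, ih]
          rw [this]; simp
        · rw [hitProb_of_mem (h hd ▸ hd)]; norm_num
      have h1 := missProb_nonneg hw m D x
      rw [missProb, if_pos h]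
      linarith
    · have hD : D.Nonempty := by
        by_contra hD
        exact h (by simp [Set.not_nonempty_iff_eq_empty.1 hD])
      rw [missProb, if_neg h]
      exact one_le_missProb_add_hitProb hw hD m x
  | succ k ih =>
    rw [Nat.add_right_comm, missProb, missProb, Function.iterate_succ_apply', ← hadd]
    refine stepAvg_mono hw (fun y => (ih (D \ {x}) y).trans ?_) x
    gcongr
    exact iterate_stepAvg_mono hw (fun z => hitProb_mono hw Set.sdiff_subset m z) k y

end StepAvg

/-! ### Anticoncentration -/

section Anticoncentration

variable {w : ℤ × ℤ → ℝ} (hw : IsStepWeight w)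
include hw

open Classical in
/-- A square of bounded side carries little mass after many steps: by the gradient estimate its
mass is close to that of each of `J` disjoint translates. -/
theorem iterate_stepAvg_square_le {D : ℝ} (hD : 0 < D)
    (hgrad : ∀ u : ℤ × ℤ → ℝ, (∀ x, |u x| ≤ 1) → ∀ (n : ℕ) (x y : ℤ × ℤ),
      |(stepAvg w)^[n] u (x + y) - (stepAvg w)^[n] u x| ≤
        D / √(n + 1) * (|(y.1 : ℝ)| + |(y.2 : ℝ)|))
    (l k J : ℕ) (hJ : 0 < J) (x : ℤ × ℤ) :
    (stepAvg w)^[k] (fun z => if z ∈ square l then 1 else 0) x ≤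
      1 / J + D / √(k + 1) * (J * (2 * l + 1)) := by
  set u : ℤ × ℤ → ℝ := fun z => if z ∈ square l then 1 else 0 with hu
  have hu0 : ∀ z, 0 ≤ u z := fun z => by simp only [hu]; split_ifs <;> norm_num
  have hu1 : ∀ z, |u z| ≤ 1 := fun z => by simp only [hu]; split_ifs <;> norm_num
  set y : ℕ → ℤ × ℤ := fun j => ((j * (2 * l + 1) : ℤ), 0) with hy
  have hdisj : ∀ z, ∑ j ∈ Finset.range J, u (z + y j) ≤ 1 := by
    intro z
    by_cases h : ∃ j ∈ Finset.range J, z + y j ∈ square l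
    · obtain ⟨j, hj, hz⟩ := h
      rw [Finset.sum_eq_single_of_mem j hj, hu]
      · simp [hz]
      · intro i _ hij
        simp only [hu]
        refine if_neg fun hz' => ?_
        have h1 := hz.1
        have h2 := hz'.1
        simp only [hy, Prod.fst_add, abs_le] at h1 h2
        rcases lt_or_gt_of_ne hij with h3 | h3
        · have h4 : (i : ℤ) + 1 ≤ j := by exact_mod_cast h3
          nlinarith
        · have h4 : (j : ℤ) + 1 ≤ i := by exact_mod_cast h3
          nlinarith
    · rw [Finset.sum_eq_zero]
      · exact zero_le_one
      · intro j hj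
        exact if_neg fun hz => h ⟨j, hj, hz⟩
  have h1 : ∑ j ∈ Finset.range J, (stepAvg w)^[k] u (x + y j) ≤ 1 := by
    simp only [← iterate_stepAvg_translate (w := w) u]
    rw [← iterate_stepAvg_sum]
    exact (iterate_stepAvg_mono hw hdisj k x).trans_eq (iterate_stepAvg_const hw 1 k x)
  have h2 : ∀ j ∈ Finset.range J,
      (stepAvg w)^[k] u x - D / √(k + 1) * (J * (2 * l + 1)) ≤ (stepAvg w)^[k] u (x + y j) := by
    intro j hj
    have h3 := (abs_le.1 (hgrad u hu1 k x (y j))).1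
    have h4 : |((y j).1 : ℝ)| + |((y j).2 : ℝ)| ≤ J * (2 * l + 1) := by
      have : (j : ℝ) ≤ J := by exact_mod_cast (Finset.mem_range.1 hj).le
      simp only [hy]
      push_cast
      rw [abs_zero, add_zero, abs_of_nonneg (by positivity)]
      gcongr
    have h5 := mul_le_mul_of_nonneg_left h4 (show 0 ≤ D / √((k : ℝ) + 1) by positivity)
    linarith
  have h3 := (Finset.sum_le_sum h2).trans h1
  rw [Finset.sum_const, Finset.card_range, nsmul_eq_mul] at h3
  have hJ' : (0 : ℝ) < J := by exact_mod_cast hJ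
  rw [← sub_le_iff_le_add, le_div_iff₀ hJ']
  linarith

/-- The walk is unlikely to visit a small square between the moments `k` and `k + m`. -/
theorem iterate_stepAvg_hitProb_le {D : ℝ} (hD : 0 < D)
    (hgrad : ∀ u : ℤ × ℤ → ℝ, (∀ x, |u x| ≤ 1) → ∀ (n : ℕ) (x y : ℤ × ℤ),
      |(stepAvg w)^[n] u (x + y) - (stepAvg w)^[n] u x| ≤
        D / √(n + 1) * (|(y.1 : ℝ)| + |(y.2 : ℝ)|))
    (a b k m J : ℕ) (hb : 0 < b) (hJ : 0 < J) (x : ℤ × ℤ) :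
    (stepAvg w)^[k] (hitProb w (square a) m) x ≤
      1 / J + D / √(k + 1) * (J * (2 * (a + b : ℕ) + 1)) + m / b ^ 2 := by
  classical
  have h1 : ∀ y, hitProb w (square a) m y ≤
      (if y ∈ square (a + b) then 1 else 0) + (m : ℝ) / b ^ 2 := by
    intro y
    by_cases hy : y ∈ square (a + b)
    · rw [if_pos hy]
      linarith [hitProb_le_one hw (square a) m y,
        show (0 : ℝ) ≤ (m : ℝ) / b ^ 2 by positivity]
    · rw [if_neg hy, zero_add]
      refine (hitProb_le_exitBound hw hb (x₀ := y) (fun z hz hzy => hy ?_) m y).trans_eq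
        (by simp [exitBound])
      have h2 := hz.1
      have h3 := hz.2
      have h4 := hzy.1
      have h5 := hzy.2
      simp only [Prod.fst_sub, Prod.snd_sub, abs_le] at h2 h3 h4 h5
      refine ⟨abs_le.2 ⟨?_, ?_⟩, abs_le.2 ⟨?_, ?_⟩⟩ <;> push_cast <;> omega
  have h2 := iterate_stepAvg_mono hw h1 k x
  rw [iterate_stepAvg_add, iterate_stepAvg_const hw] at h2
  exact h2.trans (add_le_add_left (iterate_stepAvg_square_le hw hD hgrad _ _ _ hJ _) _)

end Anticoncentration

/-! ### The covering probability as an iterated average -/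

theorem mem_visited_cons {n : ℕ} (s : ℤ × ℤ) (ω : Fin n → ℤ × ℤ) (z : ℤ × ℤ) :
    z ∈ visited (Fin.cons s ω : Fin (n + 1) → ℤ × ℤ) ↔ z = 0 ∨ z - s ∈ visited ω := by
  have key : ∀ k, ∑ i with (i : Fin (n + 1)).val < k + 1,
      (Fin.cons s ω : Fin (n + 1) → ℤ × ℤ) i = s + ∑ i with (i : Fin n).val < k, ω i := by
    intro k
    rw [Finset.sum_filter, Fin.sum_univ_succ, Finset.sum_filter]
    simp
  constructor
  · rintro ⟨k, hk, h⟩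
    cases k with
    | zero => left; simpa using h.symm
    | succ k =>
      right
      exact ⟨k, by omega, by rw [← h, key]; abel⟩
  · rintro (rfl | ⟨k, hk, h⟩)
    · exact ⟨0, by omega, by simp⟩
    · exact ⟨k + 1, by omega, by rw [key, h]; abel⟩

theorem missProb_le_one {w : ℤ × ℤ → ℝ} (hw : IsStepWeight w) (k : ℕ) (D : Set (ℤ × ℤ))
    (x : ℤ × ℤ) : missProb w k D x ≤ 1 := by
  induction k generalizing x D with
  | zero => simp only [missProb]; split_ifs <;> norm_num
  | succ k ih =>
    exact (stepAvg_mono hw (ih _) x).trans_eq (stepAvg_const hw 1 x)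

theorem pi_covered_eq (ν : PMF (ℤ × ℤ)) (hν : ν.support = stepSet)
    (hw : IsStepWeight fun s => (ν s).toReal) (n : ℕ) (D : Set (ℤ × ℤ)) (x : ℤ × ℤ) :
    (Measure.pi fun _ : Fin n => ν.toMeasure) {ω | ∀ d ∈ D, d - x ∈ visited ω} =
      ENNReal.ofReal (1 - missProb (fun s => (ν s).toReal) n D x) := by
  induction n generalizing D x with
  | zero =>
    have hv : ∀ ω : Fin 0 → ℤ × ℤ, visited ω = {0} := by
      intro ω
      ext z
      constructor
      · rintro ⟨k, -, h⟩
        simpa using h.symm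
      · rintro rfl
        exact ⟨0, le_rfl, by simp⟩
    simp only [hv, Set.mem_singleton_iff, sub_eq_zero, missProb]
    split_ifs with h
    · rw [show {ω : Fin 0 → ℤ × ℤ | ∀ d ∈ D, d = x} = Set.univ from
        Set.eq_univ_of_forall fun _ => h]
      simp
    · rw [show {ω : Fin 0 → ℤ × ℤ | ∀ d ∈ D, d = x} = ∅ from
        Set.eq_empty_of_forall_notMem fun _ => h]
      simp
  | succ n ih =>
    have hmp := (measurePreserving_piFinSuccAbove (fun _ : Fin (n + 1) => ν.toMeasure) 0).symm
    rw [← hmp.measure_preimage_equiv, Measure.prod_apply (Set.to_countable _).measurableSet,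
      lintegral_countable']
    have hset : ∀ s : ℤ × ℤ, Prod.mk s ⁻¹'
        ((MeasurableEquiv.piFinSuccAbove (fun _ : Fin (n + 1) => ℤ × ℤ) 0).symm ⁻¹'
          {ω | ∀ d ∈ D, d - x ∈ visited ω}) =
        {ω : Fin n → ℤ × ℤ | ∀ d ∈ D \ {x}, d - (x + s) ∈ visited ω} := by
      intro s
      ext ω
      have e : (MeasurableEquiv.piFinSuccAbove (fun _ : Fin (n + 1) => ℤ × ℤ) 0).symm (s, ω) =
          Fin.cons s ω := by
        simp [MeasurableEquiv.piFinSuccAbove]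
        rfl
      simp only [Set.mem_preimage, Set.mem_ofPred_eq, e, mem_visited_cons, sub_eq_zero,
        Set.mem_sdiff, Set.mem_singleton_iff, sub_add_eq_sub_sub]
      exact ⟨fun h d hd => (h d hd.1).resolve_left hd.2, fun h d hd =>
        or_iff_not_imp_left.2 fun hx => h d ⟨hd, hx⟩⟩
    have hterm : ∀ s : ℤ × ℤ, (Measure.pi fun _ : Fin n => ν.toMeasure) (Prod.mk s ⁻¹'
        ((MeasurableEquiv.piFinSuccAbove (fun _ : Fin (n + 1) => ℤ × ℤ) 0).symm ⁻¹'
          {ω | ∀ d ∈ D, d - x ∈ visited ω})) * ν.toMeasure {s} =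
        ENNReal.ofReal ((ν s).toReal *
          (1 - missProb (fun s => (ν s).toReal) n (D \ {x}) (x + s))) := by
      intro s
      rw [hset, ih, PMF.toMeasure_apply_singleton _ _ (measurableSet_singleton s),
        ENNReal.ofReal_mul ENNReal.toReal_nonneg, ENNReal.ofReal_toReal (ν.apply_ne_top s),
        mul_comm]
    refine (tsum_congr hterm).trans ?_
    rw [tsum_eq_sum (s := stepSet)]
    · rw [← ENNReal.ofReal_sum_of_nonneg]
      · congr 1
        simp only [mul_sub, mul_one, Finset.sum_sub_distrib]
        rw [hw.sum_eq_one]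
        rfl
      · exact fun s _ => mul_nonneg ENNReal.toReal_nonneg
          (sub_nonneg.2 (missProb_le_one hw _ _ _))
    · intro s hs
      have : ν s = 0 := by
        rw [PMF.apply_eq_zero_iff, hν]
        exact hs
      simp [this]

theorem coverProb_eq (ν : PMF (ℤ × ℤ)) (hν : ν.support = stepSet)
    (hw : IsStepWeight fun s => (ν s).toReal) (n : ℕ) (R : ℝ) :
    coverProb ν n R = 1 - missProb (fun s => (ν s).toReal) n (zsqBall R) 0 := by
  have h := pi_covered_eq ν hν hw n (zsqBall R) 0
  simp only [sub_zero] at h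
  rw [coverProb, Measure.real]
  rw [show {ω : Fin n → ℤ × ℤ | zsqBall R ⊆ visited ω} = {ω | ∀ d ∈ zsqBall R, d ∈ visited ω}
    from rfl, h, ENNReal.toReal_ofReal (sub_nonneg.2 (missProb_le_one hw _ _ _))]

/-- At most `n + 1` points are visited until the moment `n`, which bounds the radius of a ball
that can be covered. -/
theorem le_two_mul_sqrt_of_coverProb_pos {ν : PMF (ℤ × ℤ)} {n : ℕ} {R : ℝ}
    (h : 0 < coverProb ν n R) : R ≤ 2 * √(n + 1) := by
  obtain ⟨ω, hω⟩ : {ω : Fin n → ℤ × ℤ | zsqBall R ⊆ visited ω}.Nonempty := by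
    by_contra hne
    rw [Set.not_nonempty_iff_eq_empty] at hne
    simp [coverProb, hne] at h
  rcases lt_or_ge R 0 with hR | hR
  · exact hR.le.trans (by positivity)
  set j := ⌊R / 2⌋₊ with hj
  have hj1 : (j : ℝ) ≤ R / 2 := Nat.floor_le (by positivity)
  have hj2 : R / 2 < j + 1 := Nat.lt_floor_add_one _
  set B : Finset (ℤ × ℤ) := (Finset.range (j + 1) ×ˢ Finset.range (j + 1)).image
    fun p => ((p.1 : ℤ), (p.2 : ℤ)) with hB
  set V : Finset (ℤ × ℤ) := (Finset.range (n + 1)).image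
    fun k => ∑ i with (i : Fin n).val < k, ω i with hV
  have hBV : B ⊆ V := by
    intro z hz
    obtain ⟨p, hp, rfl⟩ := Finset.mem_image.1 hz
    rw [Finset.mem_product, Finset.mem_range, Finset.mem_range] at hp
    obtain ⟨k, hk, hk'⟩ := hω (show ((p.1 : ℤ), (p.2 : ℤ)) ∈ zsqBall R by
      have h1 : (p.1 : ℝ) ≤ j := by exact_mod_cast Nat.lt_succ_iff.1 hp.1
      have h2 : (p.2 : ℝ) ≤ j := by exact_mod_cast Nat.lt_succ_iff.1 hp.2
      simp only [zsqBall, Set.mem_ofPred_eq, Nat.abs_cast]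
      push_cast
      linarith)
    exact Finset.mem_image.2 ⟨k, Finset.mem_range.2 (by omega), hk'⟩
  have hcard : (j + 1) * (j + 1) ≤ n + 1 := by
    have h1 : B.card = (j + 1) * (j + 1) := by
      rw [hB, Finset.card_image_of_injective, Finset.card_product, Finset.card_range]
      rintro ⟨a, b⟩ ⟨c, d⟩ h
      simpa using h
    rw [← h1]
    exact (Finset.card_le_card hBV).trans (Finset.card_image_le.trans_eq (Finset.card_range _))
  have : (j : ℝ) + 1 ≤ √(n + 1) := by
    apply Real.le_sqrt_of_sq_le
    rw [sq]
    exact_mod_cast hcard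
  linarith

/-! ### The switch-walk-switch operator -/

section Operators

variable {F : Type*} [Group F]

/-- The element of the wreath product with lamp configuration `f` and position `x`. -/
def wreathMk (f : LampGroup ZSq F) (x : ℤ × ℤ) : WreathProduct ZSq F :=
  ⟨f, Multiplicative.ofAdd x⟩

/-- The operator of averaging over the lamp at the current position. -/
noncomputable def lampAvg [Fintype F] (φ : WreathProduct ZSq F → ℝ) (h : WreathProduct ZSq F) : ℝ :=
  ∑ b : F, (Fintype.card F : ℝ)⁻¹ * φ (h * WreathProduct.lamp ZSq b)

/-- The operator of averaging over a step of the base walk. -/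
noncomputable def walkAvg (w : ℤ × ℤ → ℝ) (φ : WreathProduct ZSq F → ℝ)
    (h : WreathProduct ZSq F) : ℝ :=
  ∑ s ∈ stepSet, w s * φ (h * SemidirectProduct.inr (Multiplicative.ofAdd s))

/-- The Markov operator of the switch-walk-switch random walk. -/
noncomputable def swsAvg [Fintype F] (w : ℤ × ℤ → ℝ) (φ : WreathProduct ZSq F → ℝ) :
    WreathProduct ZSq F → ℝ :=
  lampAvg (walkAvg w (lampAvg φ))

open Classical in
/-- The configuration `f` with the lamp at `x` changed to `c`. -/
noncomputable def setLamp (f : LampGroup ZSq F) (x : ℤ × ℤ) (c : F) : LampGroup ZSq F :=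
  ⟨Function.update f.1 (Multiplicative.ofAdd x) c,
    (f.2.union (Set.finite_singleton (Multiplicative.ofAdd x))).subset fun y hy => by
      by_cases h : y = Multiplicative.ofAdd x
      · exact Or.inr h
      · left
        simpa [Function.mem_mulSupport, Function.update_of_ne h] using hy⟩

theorem setLamp_apply (f : LampGroup ZSq F) (x z : ℤ × ℤ) (c : F) :
    (setLamp f x c).1 (Multiplicative.ofAdd z) =
      if z = x then c else f.1 (Multiplicative.ofAdd z) := by
  by_cases h : z = x
  · subst h; simp [setLamp]
  · simp [setLamp, h]

theorem single_apply (z : ℤ × ℤ) (b : F) :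
    (LampGroup.single ZSq b).1 (Multiplicative.ofAdd z) = if z = 0 then b else 1 := by
  by_cases h : z = 0
  · subst h; simp [LampGroup.single]
  · simp [LampGroup.single, h]

/-- The set of sites at which two configurations differ. -/
def diffSet (f g : LampGroup ZSq F) : Set (ℤ × ℤ) :=
  {z | f.1 (Multiplicative.ofAdd z) ≠ g.1 (Multiplicative.ofAdd z)}

theorem diffSet_eq_empty {f g : LampGroup ZSq F} (h : diffSet f g = ∅) : f = g := by
  apply Subtype.ext
  funext z
  by_contra hz
  have : z.toAdd ∈ diffSet f g := hz
  simp [h] at this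

theorem diffSet_setLamp (f g : LampGroup ZSq F) (x : ℤ × ℤ) (c : F) :
    diffSet (setLamp f x c) (setLamp g x c) = diffSet f g \ {x} := by
  ext z
  by_cases hz : z = x
  · subst hz; simp [diffSet, setLamp]
  · simp [diffSet, setLamp, hz]

theorem wreathMk_mul_lamp (f : LampGroup ZSq F) (x : ℤ × ℤ) (b : F) :
    wreathMk f x * WreathProduct.lamp ZSq b =
      wreathMk (setLamp f x (f.1 (Multiplicative.ofAdd x) * b)) x := by
  apply SemidirectProduct.ext
  · apply Subtype.ext
    funext z
    change f.1 (Multiplicative.ofAdd z.toAdd) *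
      (LampGroup.single ZSq b).1 (Multiplicative.ofAdd (-x + z.toAdd)) =
        (setLamp f x _).1 (Multiplicative.ofAdd z.toAdd)
    rw [single_apply, setLamp_apply]
    by_cases hz : z.toAdd = x
    · rw [if_pos hz, hz, neg_add_cancel, if_pos rfl]
    · rw [if_neg hz, if_neg fun h => hz (neg_add_eq_zero.1 h).symm, mul_one]
  · change Multiplicative.ofAdd x * 1 = Multiplicative.ofAdd x
    rw [mul_one]

theorem wreathMk_mul_inr (f : LampGroup ZSq F) (x s : ℤ × ℤ) :
    wreathMk f x * SemidirectProduct.inr (Multiplicative.ofAdd s) = wreathMk f (x + s) := by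
  apply SemidirectProduct.ext
  · change f * (LampGroup.shift ZSq F _) 1 = f
    rw [map_one, mul_one]
  · rfl

theorem lampAvg_wreathMk [Fintype F] (φ : WreathProduct ZSq F → ℝ) (f : LampGroup ZSq F)
    (x : ℤ × ℤ) :
    lampAvg φ (wreathMk f x) =
      ∑ c : F, (Fintype.card F : ℝ)⁻¹ * φ (wreathMk (setLamp f x c) x) := by
  simp only [lampAvg, wreathMk_mul_lamp]
  exact Equiv.sum_comp (Equiv.mulLeft (f.1 (Multiplicative.ofAdd x)))
    fun c => (Fintype.card F : ℝ)⁻¹ * φ (wreathMk (setLamp f x c) x)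

theorem walkAvg_wreathMk (w : ℤ × ℤ → ℝ) (φ : WreathProduct ZSq F → ℝ) (f : LampGroup ZSq F)
    (x : ℤ × ℤ) : walkAvg w φ (wreathMk f x) = stepAvg w (fun y => φ (wreathMk f y)) x := by
  simp only [walkAvg, wreathMk_mul_inr, stepAvg]

theorem card_inv_sum (F : Type*) [Group F] [Fintype F] :
    ∑ _c : F, (Fintype.card F : ℝ)⁻¹ = 1 := by
  rw [Finset.sum_const, Finset.card_univ, nsmul_eq_mul]
  exact mul_inv_cancel₀ (Nat.cast_ne_zero.2 Fintype.card_ne_zero)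

variable [Fintype F]

theorem lampAvg_lampAvg (φ : WreathProduct ZSq F → ℝ) : lampAvg (lampAvg φ) = lampAvg φ := by
  funext h
  have hl : ∀ b c : F, WreathProduct.lamp ZSq b * WreathProduct.lamp ZSq c =
      WreathProduct.lamp ZSq (b * c) := by
    intro b c
    rw [WreathProduct.lamp, WreathProduct.lamp, WreathProduct.lamp, ← map_mul]
    congr 1
    apply Subtype.ext
    funext z
    change (LampGroup.single ZSq b).1 (Multiplicative.ofAdd z.toAdd) *
      (LampGroup.single ZSq c).1 (Multiplicative.ofAdd z.toAdd) =
        (LampGroup.single ZSq (b * c)).1 (Multiplicative.ofAdd z.toAdd)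
    simp only [single_apply]
    split_ifs <;> simp
  have h1 : ∀ b, lampAvg φ (h * WreathProduct.lamp ZSq b) = lampAvg φ h := by
    intro b
    simp only [lampAvg, mul_assoc, hl]
    exact Equiv.sum_comp (Equiv.mulLeft b)
      fun c => (Fintype.card F : ℝ)⁻¹ * φ (h * WreathProduct.lamp ZSq c)
  rw [lampAvg]
  simp only [h1]
  rw [← Finset.sum_mul, card_inv_sum, one_mul]

theorem lampAvg_mono {φ ψ : WreathProduct ZSq F → ℝ} (h : ∀ g, φ g ≤ ψ g)
    (g : WreathProduct ZSq F) : lampAvg φ g ≤ lampAvg ψ g :=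
  Finset.sum_le_sum fun _ _ => mul_le_mul_of_nonneg_left (h _) (by positivity)

omit [Fintype F] in
theorem walkAvg_mono {w : ℤ × ℤ → ℝ} (hw : IsStepWeight w) {φ ψ : WreathProduct ZSq F → ℝ}
    (h : ∀ g, φ g ≤ ψ g) (g : WreathProduct ZSq F) : walkAvg w φ g ≤ walkAvg w ψ g :=
  Finset.sum_le_sum fun _ hs => mul_le_mul_of_nonneg_left (h _) (hw.nonneg hs)

theorem swsAvg_mono {w : ℤ × ℤ → ℝ} (hw : IsStepWeight w) {φ ψ : WreathProduct ZSq F → ℝ}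
    (h : ∀ g, φ g ≤ ψ g) (g : WreathProduct ZSq F) : swsAvg w φ g ≤ swsAvg w ψ g :=
  lampAvg_mono (walkAvg_mono hw (lampAvg_mono h)) g

theorem iterate_swsAvg_mono {w : ℤ × ℤ → ℝ} (hw : IsStepWeight w)
    {φ ψ : WreathProduct ZSq F → ℝ} (h : ∀ g, φ g ≤ ψ g) (n : ℕ) (g : WreathProduct ZSq F) :
    (swsAvg w)^[n] φ g ≤ (swsAvg w)^[n] ψ g := by
  induction n generalizing g with
  | zero => exact h g
  | succ n ih =>
    rw [Function.iterate_succ_apply', Function.iterate_succ_apply']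
    exact swsAvg_mono hw ih g

theorem lampAvg_add (φ ψ : WreathProduct ZSq F → ℝ) :
    lampAvg (fun g => φ g + ψ g) = fun g => lampAvg φ g + lampAvg ψ g := by
  funext g; simp [lampAvg, mul_add, Finset.sum_add_distrib]

omit [Fintype F] in
theorem walkAvg_add (w : ℤ × ℤ → ℝ) (φ ψ : WreathProduct ZSq F → ℝ) :
    walkAvg w (fun g => φ g + ψ g) = fun g => walkAvg w φ g + walkAvg w ψ g := by
  funext g; simp [walkAvg, mul_add, Finset.sum_add_distrib]

theorem iterate_swsAvg_add (w : ℤ × ℤ → ℝ) (φ ψ : WreathProduct ZSq F → ℝ) (n : ℕ) :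
    (swsAvg w)^[n] (fun g => φ g + ψ g) =
      fun g => (swsAvg w)^[n] φ g + (swsAvg w)^[n] ψ g := by
  induction n generalizing φ ψ with
  | zero => rfl
  | succ n ih =>
    simp only [Function.iterate_succ_apply]
    rw [← ih]
    congr 1
    simp only [swsAvg, lampAvg_add, walkAvg_add]

/-- On functions of the position alone, the walk on the wreath product acts as its projection
to `ℤ²`. -/
theorem iterate_swsAvg_right (w : ℤ × ℤ → ℝ) (u : ℤ × ℤ → ℝ) (n : ℕ) :
    (swsAvg w)^[n] (fun g : WreathProduct ZSq F => u g.right.toAdd) =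
      fun g => (stepAvg w)^[n] u g.right.toAdd := by
  induction n generalizing u with
  | zero => rfl
  | succ n ih =>
    simp only [Function.iterate_succ_apply]
    rw [← ih]
    congr 1
    have h1 : ∀ v : ℤ × ℤ → ℝ, lampAvg (fun g : WreathProduct ZSq F => v g.right.toAdd) =
        fun g => v g.right.toAdd := by
      intro v
      funext g
      simp only [lampAvg, WreathProduct.lamp, SemidirectProduct.mul_right,
        SemidirectProduct.right_inl, mul_one]
      rw [← Finset.sum_mul, card_inv_sum, one_mul]
    have h2 : walkAvg w (fun g : WreathProduct ZSq F => u g.right.toAdd) =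
        fun g => stepAvg w u g.right.toAdd := by
      funext g
      simp only [walkAvg, stepAvg, SemidirectProduct.mul_right, SemidirectProduct.right_inr,
        toAdd_mul, toAdd_ofAdd]
    rw [swsAvg, h1, h2, h1]

theorem iterate_swsAvg_const {w : ℤ × ℤ → ℝ} (hw : IsStepWeight w) (c : ℝ) (n : ℕ)
    (g : WreathProduct ZSq F) : (swsAvg w)^[n] (fun _ => c) g = c := by
  have := congrFun (iterate_swsAvg_right (F := F) w (fun _ => c) n) g
  rw [this]
  exact iterate_stepAvg_const hw c n _

theorem iterate_swsAvg_mem_Icc {w : ℤ × ℤ → ℝ} (hw : IsStepWeight w)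
    {φ : WreathProduct ZSq F → ℝ} (hφ : ∀ g, φ g ∈ Set.Icc 0 1) (n : ℕ)
    (g : WreathProduct ZSq F) : (swsAvg w)^[n] φ g ∈ Set.Icc 0 1 :=
  ⟨(iterate_swsAvg_const hw 0 n g).symm.trans_le
    (iterate_swsAvg_mono hw (fun g => (hφ g).1) n g),
   (iterate_swsAvg_mono hw (fun g => (hφ g).2) n g).trans_eq (iterate_swsAvg_const hw 1 n g)⟩

/-! ### Forgetting the initial configuration -/

/-- A weighted mean of differences is at most the weighted mean of their bounds. -/
theorem abs_sum_mul_sub_le {ι : Type*} (t : Finset ι) {c a b d : ι → ℝ}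
    (hc : ∀ i ∈ t, 0 ≤ c i) (h : ∀ i ∈ t, |a i - b i| ≤ d i) :
    |∑ i ∈ t, c i * a i - ∑ i ∈ t, c i * b i| ≤ ∑ i ∈ t, c i * d i := by
  rw [← Finset.sum_sub_distrib]
  refine (Finset.abs_sum_le_sum_abs _ _).trans (Finset.sum_le_sum fun i hi => ?_)
  rw [← mul_sub, abs_mul, abs_of_nonneg (hc i hi)]
  exact mul_le_mul_of_nonneg_left (h i hi) (hc i hi)

open Classical in
/-- Every visited lamp is rerandomized, so two initial configurations can be told apart only if
the walk fails to cover the set on which they differ. -/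
theorem abs_lampAvg_iterate_sub_le {w : ℤ × ℤ → ℝ} (hw : IsStepWeight w)
    {φ : WreathProduct ZSq F → ℝ} (hφ : ∀ g, φ g ∈ Set.Icc 0 1) (k : ℕ)
    (f g : LampGroup ZSq F) (x : ℤ × ℤ) :
    |lampAvg ((swsAvg w)^[k] φ) (wreathMk f x) - lampAvg ((swsAvg w)^[k] φ) (wreathMk g x)| ≤
      missProb w k (diffSet f g) x := by
  induction k generalizing f g x with
  | zero =>
    rw [lampAvg_wreathMk, lampAvg_wreathMk, missProb, Function.iterate_zero, id]
    refine (abs_sum_mul_sub_le (d := fun _ => if diffSet f g ⊆ {x} then 0 else 1) _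
      (fun _ _ => by positivity) fun c _ => ?_).trans_eq ?_
    · split_ifs with h
      · have : setLamp f x c = setLamp g x c := by
          apply diffSet_eq_empty
          rw [diffSet_setLamp, Set.sdiff_eq_empty.2 h]
        rw [this, sub_self, abs_zero]
      · have h1 := hφ (wreathMk (setLamp f x c) x)
        have h2 := hφ (wreathMk (setLamp g x c) x)
        rw [abs_le]
        constructor <;> linarith [h1.1, h1.2, h2.1, h2.2]
    · rw [← Finset.sum_mul, card_inv_sum, one_mul]
  | succ k ih =>
    rw [Function.iterate_succ_apply', swsAvg, lampAvg_lampAvg, lampAvg_wreathMk,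
      lampAvg_wreathMk]
    refine (abs_sum_mul_sub_le (d := fun _ => missProb w (k + 1) (diffSet f g) x) _
      (fun _ _ => by positivity) fun c _ => ?_).trans_eq ?_
    · rw [walkAvg_wreathMk, walkAvg_wreathMk, missProb]
      refine abs_sum_mul_sub_le _ (fun s hs => hw.nonneg hs) fun s _ => ?_
      rw [← diffSet_setLamp f g x c]
      exact ih _ _ _
    · rw [← Finset.sum_mul, card_inv_sum, one_mul]

theorem abs_iterate_swsAvg_sub_le {w : ℤ × ℤ → ℝ} (hw : IsStepWeight w)
    {φ : WreathProduct ZSq F → ℝ} (hφ : ∀ g, φ g ∈ Set.Icc 0 1) {k : ℕ} (hk : 0 < k)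
    (f g : LampGroup ZSq F) (x : ℤ × ℤ) :
    |(swsAvg w)^[k] φ (wreathMk f x) - (swsAvg w)^[k] φ (wreathMk g x)| ≤
      missProb w k (diffSet f g) x := by
  obtain ⟨k, rfl⟩ := Nat.exists_eq_succ_of_ne_zero hk.ne'
  have h : lampAvg ((swsAvg w)^[k.succ] φ) = (swsAvg w)^[k.succ] φ := by
    rw [Function.iterate_succ_apply', swsAvg, lampAvg_lampAvg]
  have := abs_lampAvg_iterate_sub_le hw hφ k.succ f g x
  rwa [h] at this

/-! ### Confinement to a square -/

/-- All nontrivial lamps and the position of `g` lie in the square of side `2 l`. -/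
def ConfinedTo (l : ℕ) (g : WreathProduct ZSq F) : Prop :=
  (∀ z : ℤ × ℤ, g.left.1 (Multiplicative.ofAdd z) ≠ 1 → z ∈ square l) ∧
    g.right.toAdd ∈ square l

theorem square_mono {a b : ℕ} (h : a ≤ b) : square a ⊆ square b := fun z hz =>
  ⟨hz.1.trans (by exact_mod_cast h), hz.2.trans (by exact_mod_cast h)⟩

theorem add_mem_square {a b : ℕ} {x y : ℤ × ℤ} (hx : x ∈ square a) (hy : y ∈ square b) :
    x + y ∈ square (a + b) := by
  refine ⟨(abs_add_le _ _).trans ?_, (abs_add_le _ _).trans ?_⟩ <;> push_cast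
  · exact add_le_add hx.1 hy.1
  · exact add_le_add hx.2 hy.2

theorem stepSet_subset_square {s : ℤ × ℤ} (hs : s ∈ stepSet) : s ∈ square 1 := by
  have : ∀ s ∈ stepSet, |s.1| ≤ 1 ∧ |s.2| ≤ 1 := by decide
  simpa [square] using this s hs

omit [Fintype F] in
theorem setLamp_support {l : ℕ} {f : LampGroup ZSq F} {x : ℤ × ℤ}
    (hf : ∀ z : ℤ × ℤ, f.1 (Multiplicative.ofAdd z) ≠ 1 → z ∈ square l) (hx : x ∈ square l)
    (c : F) (z : ℤ × ℤ) (hz : (setLamp f x c).1 (Multiplicative.ofAdd z) ≠ 1) :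
    z ∈ square l := by
  by_cases h : z = x
  · rwa [h]
  · refine hf z ?_
    simpa [setLamp, h] using hz

open Classical in
/-- The walk with lamps and position initially confined to a square is unlikely to leave a much
larger square soon. -/
theorem iterate_swsAvg_not_confined_le {w : ℤ × ℤ → ℝ} (hw : IsStepWeight w) {l : ℕ} (hl : 0 < l)
    (m : ℕ) (f : LampGroup ZSq F) (x : ℤ × ℤ)
    (hf : ∀ z : ℤ × ℤ, f.1 (Multiplicative.ofAdd z) ≠ 1 → z ∈ square (l + 1)) :
    (swsAvg w)^[m] (fun g => if ConfinedTo (l + 1) g then 0 else 1) (wreathMk f x) ≤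
      exitBound 0 l m x := by
  set φ : WreathProduct ZSq F → ℝ := fun g => if ConfinedTo (l + 1) g then 0 else 1 with hφ
  have hφ1 : ∀ g, φ g ∈ Set.Icc (0 : ℝ) 1 := fun g => by
    simp only [hφ]; split_ifs <;> simp
  induction m generalizing f x with
  | zero =>
    by_cases hx : x ∈ square l
    · have : ConfinedTo (l + 1) (wreathMk f x) := ⟨hf, square_mono (Nat.le_succ l) hx⟩
      rw [Function.iterate_zero, id, hφ]
      simp only [if_pos this]
      exact exitBound_nonneg _ _ _ _
    · exact (hφ1 _).2.trans (one_le_exitBound hl _ (by rwa [sub_zero]))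
  | succ m ih =>
    by_cases hx : x ∈ square l
    · rw [Function.iterate_succ_apply', swsAvg, lampAvg_wreathMk]
      refine (Finset.sum_le_sum (g := fun _ => (Fintype.card F : ℝ)⁻¹ *
        exitBound 0 l (m + 1) x) fun c _ => ?_).trans_eq ?_
      · refine mul_le_mul_of_nonneg_left ?_ (by positivity)
        rw [walkAvg_wreathMk]
        refine le_trans (Finset.sum_le_sum fun s hs => ?_) (stepAvg_exitBound_le hw 0 l m x)
        refine mul_le_mul_of_nonneg_left ?_ (hw.nonneg hs)
        simp only [lampAvg_wreathMk]
        refine (Finset.sum_le_sum (g := fun _ => (Fintype.card F : ℝ)⁻¹ *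
          exitBound 0 l m (x + s)) fun d _ => ?_).trans_eq ?_
        · refine mul_le_mul_of_nonneg_left (ih _ _ ?_) (by positivity)
          exact setLamp_support (setLamp_support hf (square_mono (Nat.le_succ l) hx) c)
            (add_mem_square hx (stepSet_subset_square hs)) d
        · rw [← Finset.sum_mul, card_inv_sum, one_mul]
      · rw [← Finset.sum_mul, card_inv_sum, one_mul]
    · exact (iterate_swsAvg_mem_Icc hw hφ1 _ _).2.trans
        (one_le_exitBound hl _ (by rwa [sub_zero]))

end Operators

/-! ### Dependence of the law at time `n` on the starting point -/

section Comparison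

variable {F : Type*} [Group F] [Fintype F] {w : ℤ × ℤ → ℝ} (hw : IsStepWeight w)
include hw

open Classical in
/-- Up to the probability of not covering a square, the function `(swsAvg w)^[k] φ` depends only
on the position, at elements which are confined to a smaller square. -/
theorem abs_iterate_swsAvg_sub_wreathMk_one_le {φ : WreathProduct ZSq F → ℝ}
    (hφ : ∀ g, φ g ∈ Set.Icc 0 1) {k : ℕ} (hk : 0 < k) (l : ℕ) (g : WreathProduct ZSq F) :
    |(swsAvg w)^[k] φ g - (swsAvg w)^[k] φ (wreathMk 1 g.right.toAdd)| ≤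
      missProb w k (square (l + l)) 0 + if ConfinedTo l g then 0 else 1 := by
  split_ifs with hg
  · rw [add_zero]
    refine (abs_iterate_swsAvg_sub_le hw hφ hk g.left 1 g.right.toAdd).trans ?_
    have h := missProb_translate (w := w) k (diffSet g.left 1) 0 g.right.toAdd
    rw [zero_add] at h
    rw [← h]
    refine missProb_mono hw k (fun z hz => ?_) 0
    have h1 := hg.1 _ hz
    have h2 := hg.2
    simp only [square, Set.mem_ofPred_eq, Prod.fst_add, Prod.snd_add, abs_le] at h1 h2 ⊢
    push_cast
    omega
  · have h1 := iterate_swsAvg_mem_Icc hw hφ k g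
    have h2 := iterate_swsAvg_mem_Icc hw hφ k (wreathMk 1 g.right.toAdd)
    have h3 := missProb_nonneg hw k (square (l + l)) 0
    rw [abs_le]
    constructor <;> linarith [h1.1, h1.2, h2.1, h2.2]

/-- After `m` steps only the position matters, because the remaining `k` steps refresh all lamps
that may have been switched on; the position after `m` steps is handled by the walk on `ℤ²`. -/
theorem abs_iterate_swsAvg_sub_iterate_stepAvg_le {φ : WreathProduct ZSq F → ℝ}
    (hφ : ∀ g, φ g ∈ Set.Icc 0 1) {k : ℕ} (hk : 0 < k) {l : ℕ} (hl : 0 < l) (m : ℕ)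
    {g : WreathProduct ZSq F} (hg : ConfinedTo (l + 1) g) :
    |(swsAvg w)^[m + k] φ g -
        (stepAvg w)^[m] (fun x => (swsAvg w)^[k] φ (wreathMk 1 x)) g.right.toAdd| ≤
      missProb w k (square (l + 1 + (l + 1))) 0 + exitBound 0 l m g.right.toAdd := by
  classical
  set u : ℤ × ℤ → ℝ := fun x => (swsAvg w)^[k] φ (wreathMk 1 x) with hu
  set η := missProb w k (square (l + 1 + (l + 1))) 0
  set bad : WreathProduct ZSq F → ℝ := fun g => if ConfinedTo (l + 1) g then 0 else 1 with hbad
  have h0 := fun g => abs_le.1 (abs_iterate_swsAvg_sub_wreathMk_one_le hw hφ hk (l + 1) g)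
  have h1 : ∀ g, (swsAvg w)^[k] φ g ≤ u g.right.toAdd + (η + bad g) := fun g => by
    linarith [(h0 g).2]
  have h2 : ∀ g : WreathProduct ZSq F, u g.right.toAdd ≤ (swsAvg w)^[k] φ g + (η + bad g) :=
    fun g => by linarith [(h0 g).1]
  have h3 := iterate_swsAvg_mono hw h1 m g
  have h4 := iterate_swsAvg_mono hw h2 m g
  simp only [iterate_swsAvg_add] at h3 h4
  rw [iterate_swsAvg_right, iterate_swsAvg_const hw] at h3 h4
  have h5 := iterate_swsAvg_not_confined_le hw hl m g.left g.right.toAdd hg.1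
  rw [Function.iterate_add_apply, abs_le]
  change (swsAvg w)^[m] bad g ≤ _ at h5
  constructor <;> linarith

theorem abs_iterate_swsAvg_sub_one_le {D : ℝ}
    (hgrad : ∀ u : ℤ × ℤ → ℝ, (∀ x, |u x| ≤ 1) → ∀ (n : ℕ) (x y : ℤ × ℤ),
      |(stepAvg w)^[n] u (x + y) - (stepAvg w)^[n] u x| ≤
        D / √(n + 1) * (|(y.1 : ℝ)| + |(y.2 : ℝ)|))
    {φ : WreathProduct ZSq F → ℝ} (hφ : ∀ g, φ g ∈ Set.Icc 0 1) {k : ℕ} (hk : 0 < k) {l : ℕ}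
    (hl : 0 < l) (m : ℕ) {g : WreathProduct ZSq F} (hg : ConfinedTo (l + 1) g) :
    |(swsAvg w)^[m + k] φ g - (swsAvg w)^[m + k] φ 1| ≤
      2 * missProb w k (square (l + 1 + (l + 1))) 0 + exitBound 0 l m g.right.toAdd +
        exitBound 0 l m 0 +
        D / √(m + 1) * (|(g.right.toAdd.1 : ℝ)| + |(g.right.toAdd.2 : ℝ)|) := by
  have h1 := abs_le.1 (abs_iterate_swsAvg_sub_iterate_stepAvg_le hw hφ hk hl m hg)
  have h2 := abs_le.1 (abs_iterate_swsAvg_sub_iterate_stepAvg_le hw hφ hk hl m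
    (g := (1 : WreathProduct ZSq F)) ⟨fun z hz => absurd rfl hz, by simp [square]; omega⟩)
  have h3 := abs_le.1 (hgrad (fun x => (swsAvg w)^[k] φ (wreathMk 1 x)) (fun x => by
    have := iterate_swsAvg_mem_Icc hw hφ k (wreathMk 1 x)
    rw [abs_of_nonneg this.1]
    exact this.2) m 0 g.right.toAdd)
  rw [zero_add] at h3
  rw [SemidirectProduct.one_right, toAdd_one] at h2
  rw [abs_le]
  constructor <;> linarith [h1.1, h1.2, h2.1, h2.2, h3.1, h3.2]

end Comparison

/-! ### The scale of the covering radius -/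

/-- A scale which is negligible against a covering radius is negligible against `√n` as well. -/
theorem eventually_le_of_isCoveringRadius {ν : PMF (ℤ × ℤ)} {r r' : ℕ → ℝ}
    (hr : IsCoveringRadius ν r) (hr' : Tendsto (fun n => r' n / r n) atTop (𝓝 0)) {C θ B : ℝ}
    (hC : 0 < C) (hθ : 0 < θ) (hB : 0 < B) :
    ∀ᶠ n : ℕ in atTop, ∀ ρ : ℝ, 0 ≤ ρ → ρ ≤ C * r' n → ρ ≤ θ * r n ∧ B * ρ ^ 2 ≤ n := by
  obtain ⟨c, hc, hcov⟩ := hr.2 (1 / 2) (by norm_num)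
  -- `τ` is chosen so that `B (C τ (2 / c))² (n + 1) ≤ n`.
  set τ : ℝ := c / (2 * C * √(2 * B)) with hτ
  have hτ0 : 0 < τ := by positivity
  have h1 := hr'.eventually (gt_mem_nhds (show 0 < θ / C by positivity))
  have h2 := hr'.eventually (gt_mem_nhds hτ0)
  filter_upwards [hr.1, hcov, h1, h2, eventually_ge_atTop 1] with n hn hcn h1 h2 hn1 ρ hρ0 hρ
  rw [div_lt_iff₀ hn] at h1 h2
  have h3 : c * r n ≤ 2 * √(n + 1) := le_two_mul_sqrt_of_coverProb_pos (by linarith)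
  refine ⟨?_, ?_⟩
  · calc ρ ≤ C * r' n := hρ
      _ ≤ C * (θ / C * r n) := by gcongr
      _ = θ * r n := by field_simp
  · have hs : 0 < √(2 * B) := by positivity
    have h4 : ρ * √(2 * B) ≤ √(n + 1) := by
      calc ρ * √(2 * B) ≤ C * (τ * r n) * √(2 * B) := by
            gcongr
            exact hρ.trans (by gcongr)
        _ = (c * r n) / 2 := by rw [hτ]; field_simp
        _ ≤ √(n + 1) := by linarith
    have h5 := pow_le_pow_left₀ (by positivity) h4 2
    rw [mul_pow, Real.sq_sqrt (by positivity), Real.sq_sqrt (by positivity)] at h5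
    have h6 : (1 : ℝ) ≤ n := by exact_mod_cast hn1
    linarith

theorem exists_nat_ge_and_pos (a : ℝ) : ∃ N : ℕ, 0 < N ∧ a ≤ N := by
  obtain ⟨N, hN⟩ := exists_nat_ge a
  exact ⟨N + 1, N.succ_pos, hN.trans (by push_cast; linarith)⟩

/-- Starting the walk at an element of size negligible against the covering radius, instead of
at the identity, changes its law at time `n` by little in total variation. -/
theorem eventually_abs_iterate_swsAvg_sub_le {F : Type*} [Group F] [Fintype F]
    {ν : PMF (ℤ × ℤ)} (hν : ν.support = stepSet) (hw : IsStepWeight fun s => (ν s).toReal)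
    {r r' : ℕ → ℝ} (hr : IsCoveringRadius ν r)
    (hr' : Tendsto (fun n => r' n / r n) atTop (𝓝 0)) {C : ℝ} (hC : 0 < C) {δ : ℝ}
    (hδ : 0 < δ) :
    ∀ᶠ n : ℕ in atTop, ∀ ρ : ℕ, 0 < ρ → (ρ : ℝ) ≤ C * r' n →
      ∀ g : WreathProduct ZSq F, ConfinedTo ρ g →
        ∀ φ : WreathProduct ZSq F → ℝ, (∀ h, φ h ∈ Set.Icc 0 1) →
          |(swsAvg fun s => (ν s).toReal)^[n] φ g - (swsAvg fun s => (ν s).toReal)^[n] φ 1| ≤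
            δ := by
  set w : ℤ × ℤ → ℝ := fun s => (ν s).toReal with hw_def
  obtain ⟨D, hD, hgrad⟩ := exists_gradient_bound hw
  -- The walk is run for `K ρ²` steps to forget its starting position, during which it stays in
  -- a square of side about `2 Λ ρ`; the parameter `J` serves to show that it is not back near the
  -- origin during the last `K ρ²` steps before time `n`.
  obtain ⟨K, hK, hK'⟩ := exists_nat_ge_and_pos ((8 * D / δ) ^ 2)
  obtain ⟨Λ, hΛ, hΛ'⟩ := exists_nat_ge_and_pos (16 * (2 + K) / δ)
  obtain ⟨J, hJ, hJ'⟩ := exists_nat_ge_and_pos (16 / δ)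
  obtain ⟨c, hc, hcov⟩ := hr.2 (δ / 16) (by positivity)
  set κ : ℝ := (176 * D * J * Λ / δ) ^ 2 with hκ
  have hKr : (0 : ℝ) < K := by exact_mod_cast hK
  have hΛr : (1 : ℝ) ≤ Λ := by exact_mod_cast hΛ
  have hJr : (0 : ℝ) < J := by exact_mod_cast hJ
  filter_upwards [hcov, eventually_le_of_isCoveringRadius hr hr' hC
    (θ := c / (8 * Λ)) (B := κ + K + 1) (by positivity) (by positivity)] with n hcn hn ρ hρ hρ'
    g hg φ hφ
  obtain ⟨hn1, hn2⟩ := hn ρ (Nat.cast_nonneg _) hρ'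
  have hρr : (1 : ℝ) ≤ ρ := by exact_mod_cast hρ
  have hκ0 : 0 ≤ κ := sq_nonneg _
  have hmn : K * ρ ^ 2 ≤ n := by
    have : (K : ℝ) * ρ ^ 2 ≤ n := by
      linarith [mul_nonneg hκ0 (sq_nonneg (ρ : ℝ)), sq_nonneg (ρ : ℝ)]
    exact_mod_cast this
  obtain ⟨k, rfl⟩ := Nat.exists_eq_add_of_le hmn
  set m := K * ρ ^ 2 with hm
  set l := Λ * ρ with hl_def
  have hl : 0 < l := Nat.mul_pos hΛ hρ
  have hmr : (m : ℝ) = K * ρ ^ 2 := by rw [hm]; push_cast; rfl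
  have hlr : (l : ℝ) = Λ * ρ := by rw [hl_def]; push_cast; rfl
  have hl1 : (1 : ℝ) ≤ l := by exact_mod_cast hl
  have hkκ : κ * ρ ^ 2 + 1 ≤ k := by
    push_cast at hn2
    rw [hmr] at hn2
    linarith [one_le_pow₀ hρr (n := 2)]
  have hk : 0 < k := by
    have : (0 : ℝ) < k := by linarith [mul_nonneg hκ0 (sq_nonneg (ρ : ℝ))]
    exact_mod_cast this
  have hΛ2 : (2 + K : ℝ) / Λ ^ 2 ≤ δ / 16 := by
    rw [div_le_iff₀ (by positivity)]
    rw [div_le_iff₀ hδ] at hΛ'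
    have : (Λ : ℝ) * δ ≤ Λ ^ 2 * δ := by
      gcongr
      exact le_self_pow₀ hΛr two_ne_zero
    linarith
  have hKΛ : (m : ℝ) / l ^ 2 ≤ δ / 16 := by
    refine le_trans ?_ hΛ2
    rw [hmr, hlr, mul_pow, mul_div_mul_right _ _ (by positivity)]
    gcongr
    linarith
  have hgsq : ConfinedTo (l + 1) g := by
    have : ρ ≤ l + 1 := (Nat.le_mul_of_pos_left ρ hΛ).trans (Nat.le_succ _)
    exact ⟨fun z hz => square_mono this (hg.1 z hz), square_mono this hg.2⟩
  have hx1 : |(g.right.toAdd.1 : ℝ)| ≤ ρ := by exact_mod_cast hg.2.1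
  have hx2 : |(g.right.toAdd.2 : ℝ)| ≤ ρ := by exact_mod_cast hg.2.2
  have hmiss : missProb w k (square (l + 1 + (l + 1))) 0 ≤ δ / 4 := by
    have h1 := missProb_le_add hw m k (square (l + 1 + (l + 1))) 0
    have h2 : missProb w (k + m) (square (l + 1 + (l + 1))) 0 ≤ δ / 16 := by
      rw [coverProb_eq ν hν hw, add_comm m k] at hcn
      refine (missProb_mono hw _ (E := zsqBall (c * r (k + m))) (fun z hz => ?_) 0).trans
        (by linarith)
      have h3 : (|z.1| : ℝ) ≤ l + 1 + (l + 1) := by exact_mod_cast hz.1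
      have h4 : (|z.2| : ℝ) ≤ l + 1 + (l + 1) := by exact_mod_cast hz.2
      rw [add_comm m k, div_mul_eq_mul_div, le_div_iff₀ (by positivity)] at hn1
      change ((|z.1| + |z.2| : ℤ) : ℝ) ≤ _
      push_cast
      linarith
    have h3 := iterate_stepAvg_hitProb_le hw hD hgrad (l + 1 + (l + 1)) l k m J hl hJ 0
    have h4 : (1 : ℝ) / J ≤ δ / 16 := by
      rw [div_le_iff₀ hδ] at hJ'
      rw [div_le_iff₀ hJr]
      linarith
    have h5 : D / √(k + 1) * (J * (2 * ((l + 1 + (l + 1) + l : ℕ) : ℝ) + 1)) ≤ δ / 16 := by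
      have h6 : 176 * D * J * Λ / δ * ρ ≤ √((k : ℝ) + 1) := by
        apply Real.le_sqrt_of_sq_le
        rw [mul_pow]
        linarith
      have h7 : 2 * ((l + 1 + (l + 1) + l : ℕ) : ℝ) + 1 ≤ 11 * (Λ * ρ) := by
        push_cast
        linarith
      have h8 : D * (J * (2 * ((l + 1 + (l + 1) + l : ℕ) : ℝ) + 1)) ≤ D * (J * (11 * (Λ * ρ))) := by
        gcongr
      rw [div_mul_eq_mul_div, div_le_iff₀ (by positivity)]
      rw [div_mul_eq_mul_div, div_le_iff₀ hδ] at h6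
      linarith
    linarith
  have hexit : ∀ x : ℤ × ℤ, |(x.1 : ℝ)| ≤ ρ → |(x.2 : ℝ)| ≤ ρ → exitBound 0 l m x ≤ δ / 16 := by
    intro x h1 h2
    refine le_trans ?_ hΛ2
    rw [exitBound, hlr, mul_pow, ← mul_div_mul_right (2 + K : ℝ) _
      (show (ρ : ℝ) ^ 2 ≠ 0 by positivity), hmr]
    gcongr
    have h3 := pow_le_pow_left₀ (abs_nonneg _) h1 2
    have h4 := pow_le_pow_left₀ (abs_nonneg _) h2 2
    rw [sq_abs] at h3 h4
    simp only [Prod.fst_zero, Prod.snd_zero, sub_zero]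
    linarith
  have hgr : D / √((m : ℝ) + 1) * (|(g.right.toAdd.1 : ℝ)| + |(g.right.toAdd.2 : ℝ)|) ≤ δ / 4 := by
    have h1 : 8 * D / δ * ρ ≤ √((m : ℝ) + 1) := by
      apply Real.le_sqrt_of_sq_le
      rw [mul_pow, hmr]
      linarith [mul_le_mul_of_nonneg_right hK' (sq_nonneg (ρ : ℝ))]
    have h2 : D * (|(g.right.toAdd.1 : ℝ)| + |(g.right.toAdd.2 : ℝ)|) ≤ D * (ρ + ρ) := by gcongr
    rw [div_mul_eq_mul_div, div_le_iff₀ (by positivity)]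
    rw [div_mul_eq_mul_div, div_le_iff₀ hδ] at h1
    linarith
  have h1 := abs_iterate_swsAvg_sub_one_le hw hgrad hφ hk hl m hgsq
  have h2 := hexit _ hx1 hx2
  have h3 := hexit 0 (by simp) (by simp)
  linarith

/-! ### Convolution powers as iterates of the Markov operator -/

theorem PMF.tsum_bind_mul {α β : Type*} (p : PMF α) (f : α → PMF β) (φ : β → ℝ≥0∞) :
    ∑' b, p.bind f b * φ b = ∑' a, p a * ∑' b, f a b * φ b := by
  simp_rw [PMF.bind_apply, ← ENNReal.tsum_mul_right, ← ENNReal.tsum_mul_left]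
  rw [ENNReal.tsum_comm]
  simp_rw [mul_assoc]

theorem PMF.tsum_map_mul {α β : Type*} (p : PMF α) (f : α → β) (φ : β → ℝ≥0∞) :
    ∑' b, p.map f b * φ b = ∑' a, p a * φ (f a) := by
  rw [PMF.map, PMF.tsum_bind_mul]
  refine tsum_congr fun a => ?_
  congr 1
  rw [tsum_eq_single (f a)]
  · simp
  · intro b hb
    simp [PMF.pure_apply, hb]

theorem PMF.tsum_conv_mul {G : Type*} [Group G] (p q : PMF G) (φ : G → ℝ≥0∞) :
    ∑' h, p.conv q h * φ h = ∑' a, p a * ∑' b, q b * φ (a * b) := by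
  simp_rw [PMF.conv, PMF.tsum_bind_mul, PMF.tsum_map_mul]

theorem PMF.tsum_convPow_mul {G : Type*} [Group G] {μ : PMF G} {T : (G → ℝ) → G → ℝ}
    (hT0 : ∀ φ : G → ℝ, (∀ g, 0 ≤ φ g) → ∀ g, 0 ≤ T φ g)
    (hT : ∀ φ : G → ℝ, (∀ g, 0 ≤ φ g) → ∀ g,
      ∑' s, μ s * ENNReal.ofReal (φ (g * s)) = ENNReal.ofReal (T φ g))
    (n : ℕ) {φ : G → ℝ} (hφ : ∀ g, 0 ≤ φ g) (g : G) :
    ∑' h, μ.convPow n h * ENNReal.ofReal (φ (g * h)) = ENNReal.ofReal (T^[n] φ g) := by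
  induction n generalizing φ with
  | zero =>
    rw [PMF.convPow, tsum_eq_single 1]
    · simp
    · intro b hb
      simp [PMF.pure_apply, hb]
  | succ n ih =>
    rw [PMF.convPow, PMF.tsum_conv_mul, Function.iterate_succ_apply, ← ih (hT0 φ hφ)]
    simp_rw [← mul_assoc g, hT φ hφ]

theorem PMF.conv_assoc {G : Type*} [Group G] (p q s : PMF G) :
    (p.conv q).conv s = p.conv (q.conv s) := by
  simp only [PMF.conv, PMF.map, PMF.bind_bind, PMF.pure_bind, Function.comp_def, mul_assoc]

theorem PMF.pure_one_conv {G : Type*} [Group G] (p : PMF G) : (PMF.pure 1).conv p = p := by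
  simp only [PMF.conv, PMF.pure_bind, one_mul]
  exact PMF.map_id p

theorem PMF.conv_pure_one {G : Type*} [Group G] (p : PMF G) : p.conv (PMF.pure 1) = p := by
  simp only [PMF.conv, PMF.pure_map, mul_one, PMF.bind_pure]

theorem PMF.convPow_succ_eq_conv {G : Type*} [Group G] (μ : PMF G) (n : ℕ) :
    μ.convPow (n + 1) = μ.conv (μ.convPow n) := by
  induction n with
  | zero => simp only [PMF.convPow, PMF.pure_one_conv, PMF.conv_pure_one]
  | succ n ih =>
    rw [PMF.convPow, ih, PMF.conv_assoc, ← ih]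
    rfl

theorem PMF.map_inv_conv {G : Type*} [Group G] (p q : PMF G) :
    (p.conv q).map (·⁻¹) = (q.map (·⁻¹)).conv (p.map (·⁻¹)) := by
  simp only [PMF.conv, PMF.map, PMF.bind_bind, PMF.pure_bind, Function.comp_def, mul_inv_rev]
  rw [PMF.bind_comm]

theorem PMF.map_inv_apply {G : Type*} [Group G] (p : PMF G) (g : G) :
    p.map (·⁻¹) g = p g⁻¹ := by
  rw [PMF.map_apply, tsum_eq_single g⁻¹]
  · simp
  · intro b hb
    rw [if_neg]
    rintro rfl
    simp at hb

theorem PMF.map_inv_convPow {G : Type*} [Group G] {μ : PMF G} (hμ : μ.map (·⁻¹) = μ) (n : ℕ) :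
    (μ.convPow n).map (·⁻¹) = μ.convPow n := by
  induction n with
  | zero => simp [PMF.convPow, PMF.pure_map]
  | succ n ih =>
    rw [PMF.convPow, PMF.map_inv_conv, ih, hμ]
    exact (PMF.convPow_succ_eq_conv μ n).symm

theorem PMF.map_conv {G H : Type*} [Group G] [Group H] (f : G →* H) (p q : PMF G) :
    (p.conv q).map f = (p.map f).conv (q.map f) := by
  simp only [PMF.conv, PMF.map, PMF.bind_bind, PMF.pure_bind, Function.comp_def, map_mul]

section SwitchWalkSwitch

variable {F : Type*} [Group F] [Fintype F]

theorem map_inv_uniform_lamp :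
    ((PMF.uniformOfFintype F).map (WreathProduct.lamp ZSq)).map (·⁻¹) =
      (PMF.uniformOfFintype F).map (WreathProduct.lamp ZSq) := by
  have h1 : (PMF.uniformOfFintype F).map (·⁻¹) = PMF.uniformOfFintype F := by
    ext b
    rw [PMF.map_inv_apply]
    simp
  have h2 : ∀ b : F, (WreathProduct.lamp ZSq b)⁻¹ = WreathProduct.lamp ZSq b⁻¹ := by
    intro b
    rw [WreathProduct.lamp, WreathProduct.lamp, ← map_inv]
    congr 1
    apply Subtype.ext
    funext z
    change ((LampGroup.single ZSq b).1 (Multiplicative.ofAdd z.toAdd))⁻¹ =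
      (LampGroup.single ZSq b⁻¹).1 (Multiplicative.ofAdd z.toAdd)
    simp only [single_apply]
    split_ifs <;> simp
  rw [PMF.map_comp]
  conv_rhs => rw [← h1, PMF.map_comp]
  congr 1
  funext b
  exact h2 b

theorem map_inv_of_isStandardSwitchWalkSwitch {μ : PMF (WreathProduct ZSq F)}
    (hμ : IsStandardSwitchWalkSwitch μ) : μ.map (·⁻¹) = μ := by
  obtain ⟨μA, hA, rfl⟩ := hμ
  have h : (μA.map (SemidirectProduct.inr : ZSq → WreathProduct ZSq F)).map (·⁻¹) =
      μA.map SemidirectProduct.inr := by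
    have h1 : μA.map (·⁻¹) = μA := by
      ext a
      rw [PMF.map_inv_apply, hA]
    rw [PMF.map_comp]
    conv_rhs => rw [← h1, PMF.map_comp]
    congr 1
    funext a
    exact (map_inv SemidirectProduct.inr a).symm
  rw [PMF.map_inv_conv, PMF.map_inv_conv, map_inv_uniform_lamp, h, PMF.conv_assoc]

theorem projZSq_apply {μA : PMF ZSq} (s : ℤ × ℤ) :
    projZSq ((((PMF.uniformOfFintype F).map (WreathProduct.lamp ZSq)).conv
          (μA.map SemidirectProduct.inr)).conv
            ((PMF.uniformOfFintype F).map (WreathProduct.lamp ZSq))) s =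
      μA (Multiplicative.ofAdd s) := by
  have h1 : ((PMF.uniformOfFintype F).map (WreathProduct.lamp ZSq)).map
      (SemidirectProduct.rightHom : WreathProduct ZSq F →* ZSq) = PMF.pure 1 := by
    rw [PMF.map_comp]
    exact PMF.map_const _ _
  have h2 : (μA.map SemidirectProduct.inr).map
      (SemidirectProduct.rightHom : WreathProduct ZSq F →* ZSq) = μA := by
    rw [PMF.map_comp]
    exact PMF.map_id _
  have h3 : projZSq ((((PMF.uniformOfFintype F).map (WreathProduct.lamp ZSq)).conv
          (μA.map SemidirectProduct.inr)).conv
            ((PMF.uniformOfFintype F).map (WreathProduct.lamp ZSq))) =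
      μA.map Multiplicative.toAdd := by
    conv_rhs => rw [← h2, ← PMF.conv_pure_one ((μA.map SemidirectProduct.inr).map _),
      ← PMF.pure_one_conv ((μA.map SemidirectProduct.inr).map _), ← h1, ← PMF.map_conv,
      ← PMF.map_conv,
      PMF.map_comp]
    rfl
  rw [h3, PMF.map_apply, tsum_eq_single (Multiplicative.ofAdd s)]
  · simp
  · intro b hb
    rw [if_neg]
    rintro rfl
    exact hb rfl

theorem isStepWeight_projZSq {μ : PMF (WreathProduct ZSq F)} (hμ : IsStandardSwitchWalkSwitch μ)
    (hsupp : (projZSq μ).support = stepSet) : IsStepWeight fun s => (projZSq μ s).toReal where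
  pos s hs := by
    have : s ∈ (projZSq μ).support := hsupp ▸ hs
    exact ENNReal.toReal_pos ((PMF.mem_support_iff _ _).1 this) (PMF.apply_ne_top _ _)
  symm s := by
    obtain ⟨μA, hA, rfl⟩ := hμ
    rw [projZSq_apply, projZSq_apply, ofAdd_neg, hA]
  sum_eq_one := by
    have h : ∑' s, projZSq μ s = ∑ s ∈ stepSet, projZSq μ s := by
      refine tsum_eq_sum fun s hs => ?_
      rw [PMF.apply_eq_zero_iff, hsupp]
      exact hs
    rw [← ENNReal.toReal_sum fun s _ => PMF.apply_ne_top _ _, ← h, PMF.tsum_coe,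
      ENNReal.toReal_one]

theorem tsum_lamp_mul {φ : WreathProduct ZSq F → ℝ} (hφ : ∀ g, 0 ≤ φ g)
    (g : WreathProduct ZSq F) :
    ∑' s, (PMF.uniformOfFintype F).map (WreathProduct.lamp ZSq) s * ENNReal.ofReal (φ (g * s)) =
      ENNReal.ofReal (lampAvg φ g) := by
  rw [PMF.tsum_map_mul, tsum_fintype, lampAvg, ENNReal.ofReal_sum_of_nonneg
    fun b _ => mul_nonneg (by positivity) (hφ _)]
  refine Finset.sum_congr rfl fun b _ => ?_
  rw [ENNReal.ofReal_mul (by positivity), PMF.uniformOfFintype_apply,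
    ENNReal.ofReal_inv_of_pos (Nat.cast_pos.2 Fintype.card_pos), ENNReal.ofReal_natCast]

omit [Fintype F] in
theorem tsum_walk_mul {μA : PMF ZSq}
    (hA : ∀ s : ℤ × ℤ, s ∉ stepSet → μA (Multiplicative.ofAdd s) = 0)
    {φ : WreathProduct ZSq F → ℝ} (hφ : ∀ g, 0 ≤ φ g) (g : WreathProduct ZSq F) :
    ∑' s, μA.map SemidirectProduct.inr s * ENNReal.ofReal (φ (g * s)) =
      ENNReal.ofReal (walkAvg (fun s => (μA (Multiplicative.ofAdd s)).toReal) φ g) := by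
  rw [PMF.tsum_map_mul, walkAvg, ENNReal.ofReal_sum_of_nonneg
    fun b _ => mul_nonneg ENNReal.toReal_nonneg (hφ _), ← Multiplicative.ofAdd.tsum_eq,
    tsum_eq_sum (s := stepSet)]
  · refine Finset.sum_congr rfl fun s _ => ?_
    rw [ENNReal.ofReal_mul ENNReal.toReal_nonneg, ENNReal.ofReal_toReal (PMF.apply_ne_top _ _)]
  · intro s hs
    rw [hA s hs, zero_mul]

/-- The expectation of `φ (g Z)`, where `Z` is the position of the switch-walk-switch random walk
at time `n`, is an iterate of the Markov operator. -/
theorem tsum_convPow_mul_eq_iterate_swsAvg {μ : PMF (WreathProduct ZSq F)}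
    (hμ : IsStandardSwitchWalkSwitch μ) (hsupp : (projZSq μ).support = stepSet) (n : ℕ)
    {φ : WreathProduct ZSq F → ℝ} (hφ : ∀ g, 0 ≤ φ g) (g : WreathProduct ZSq F) :
    ∑' h, μ.convPow n h * ENNReal.ofReal (φ (g * h)) =
      ENNReal.ofReal ((swsAvg fun s => (projZSq μ s).toReal)^[n] φ g) := by
  have hw := isStepWeight_projZSq hμ hsupp
  obtain ⟨μA, hA, rfl⟩ := hμ
  simp only [projZSq_apply] at hw ⊢
  have hA0 : ∀ s : ℤ × ℤ, s ∉ stepSet → μA (Multiplicative.ofAdd s) = 0 := by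
    intro s hs
    rw [← projZSq_apply (F := F), PMF.apply_eq_zero_iff, hsupp]
    exact hs
  have hl0 : ∀ φ : WreathProduct ZSq F → ℝ, (∀ g, 0 ≤ φ g) → ∀ g, 0 ≤ lampAvg φ g :=
    fun φ hφ g => Finset.sum_nonneg fun b _ => mul_nonneg (by positivity) (hφ _)
  have hw0 : ∀ φ : WreathProduct ZSq F → ℝ, (∀ g, 0 ≤ φ g) → ∀ g,
      0 ≤ walkAvg (fun s => (μA (Multiplicative.ofAdd s)).toReal) φ g :=
    fun φ hφ g => Finset.sum_nonneg fun b _ => mul_nonneg ENNReal.toReal_nonneg (hφ _)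
  refine PMF.tsum_convPow_mul (fun φ hφ => hl0 _ (hw0 _ (hl0 _ hφ))) (fun φ hφ g => ?_) n hφ g
  simp_rw [PMF.tsum_conv_mul, ← mul_assoc g, tsum_lamp_mul hφ, tsum_walk_mul hA0 (hl0 _ hφ),
    tsum_lamp_mul (hw0 _ (hl0 _ hφ))]

end SwitchWalkSwitch

/-! ### From total variation to almost invariance -/

/-- If two laws are close in total variation, their ratio is close to one outside
a set of small mass, by Markov's inequality. -/
theorem exists_set_ratio_le {G : Type*} {p q : PMF G} {δ ε : ℝ} (hε : 0 < ε)
    (hδ : 2 * δ ≤ ε ^ 2)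
    (h : ∀ W : Set G, |(q.toOuterMeasure W).toReal - (p.toOuterMeasure W).toReal| ≤ δ) :
    ∃ V : Set G, 1 - ε ≤ (p.toOuterMeasure V).toReal ∧
      ∀ x ∈ V, p x ≠ 0 ∧ |(q x).toReal / (p x).toReal - 1| ≤ ε := by
  have hsum : ∀ (s : PMF G) (W : Set G), Summable (W.indicator fun x => (s x).toReal) :=
    fun s W => (ENNReal.summable_toReal s.tsum_coe_ne_top).indicator W
  have hout : ∀ (s : PMF G) (W : Set G),
      (s.toOuterMeasure W).toReal = ∑' x, W.indicator (fun x => (s x).toReal) x := by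
    intro s W
    rw [PMF.toOuterMeasure_apply, ENNReal.tsum_toReal_eq]
    · refine tsum_congr fun x => ?_
      by_cases hx : x ∈ W <;> simp [hx]
    · intro x
      by_cases hx : x ∈ W <;> simp [hx, s.apply_ne_top]
  simp only [hout] at h ⊢
  set a : G → ℝ := fun x => (p x).toReal with ha
  set b : G → ℝ := fun x => (q x).toReal with hb
  have ha0 : ∀ x, 0 ≤ a x := fun x => ENNReal.toReal_nonneg
  set Vp : Set G := {x | (1 + ε) * a x < b x} with hVp
  set Vm : Set G := {x | b x < (1 - ε) * a x} with hVm
  set V : Set G := {x | p x ≠ 0 ∧ |b x / a x - 1| ≤ ε} with hV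
  have hp : (1 + ε) * ∑' x, Vp.indicator a x ≤ ∑' x, Vp.indicator b x := by
    rw [← tsum_mul_left]
    refine ((hsum p Vp).mul_left _).tsum_le_tsum (fun x => ?_) (hsum q Vp)
    by_cases hx : x ∈ Vp
    · simpa [hx] using le_of_lt hx
    · simp [hx]
  have hm : ∑' x, Vm.indicator b x ≤ (1 - ε) * ∑' x, Vm.indicator a x := by
    rw [← tsum_mul_left]
    refine (hsum q Vm).tsum_le_tsum (fun x => ?_) ((hsum p Vm).mul_left _)
    by_cases hx : x ∈ Vm
    · simpa [hx] using le_of_lt hx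
    · simp [hx]
  have htot : 1 ≤ ∑' x, V.indicator a x + ∑' x, Vp.indicator a x + ∑' x, Vm.indicator a x := by
    have h1 : ∑' x, a x = 1 := by
      rw [ha, ← ENNReal.tsum_toReal_eq p.apply_ne_top, p.tsum_coe, ENNReal.toReal_one]
    rw [← h1, ← (hsum p V).tsum_add (hsum p Vp),
      ← ((hsum p V).add (hsum p Vp)).tsum_add (hsum p Vm)]
    refine (ENNReal.summable_toReal p.tsum_coe_ne_top).tsum_le_tsum (fun x => ?_)
      (((hsum p V).add (hsum p Vp)).add (hsum p Vm))
    have i1 := Set.indicator_nonneg (s := V) (f := a) (fun x _ => ha0 x) x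
    have i2 := Set.indicator_nonneg (s := Vp) (f := a) (fun x _ => ha0 x) x
    have i3 := Set.indicator_nonneg (s := Vm) (f := a) (fun x _ => ha0 x) x
    change a x ≤ _
    by_cases h1 : x ∈ V
    · rw [Set.indicator_of_mem h1] at i1 ⊢
      linarith
    by_cases h2 : x ∈ Vp
    · rw [Set.indicator_of_mem h2] at i2 ⊢
      linarith
    by_cases h3 : x ∈ Vm
    · rw [Set.indicator_of_mem h3] at i3 ⊢
      linarith
    have h4 : a x = 0 := by
      by_contra hax
      have hax' : 0 < a x := lt_of_le_of_ne (ha0 x) (Ne.symm hax)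
      refine h1 ⟨fun hpx => hax (by simp [ha, hpx]), ?_⟩
      have h2' : b x ≤ (1 + ε) * a x := not_lt.1 h2
      have h3' : (1 - ε) * a x ≤ b x := not_lt.1 h3
      rw [← div_le_iff₀ hax'] at h2'
      rw [← le_div_iff₀ hax'] at h3'
      rw [abs_le]
      constructor <;> linarith
    linarith
  refine ⟨V, ?_, fun x hx => hx⟩
  have h1 := (abs_le.1 (h Vp)).2
  have h2 := (abs_le.1 (h Vm)).1
  have h3 : ε * (∑' x, Vp.indicator a x + ∑' x, Vm.indicator a x) ≤ ε * ε := by nlinarith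
  have h4 := le_of_mul_le_mul_left h3 hε
  linarith

/-! ### Word length -/

section WordLength

variable {F : Type*} [Group F]

theorem ConfinedTo.mono {a b : ℕ} (h : a ≤ b) {g : WreathProduct ZSq F} (hg : ConfinedTo a g) :
    ConfinedTo b g :=
  ⟨fun z hz => square_mono h (hg.1 z hz), square_mono h hg.2⟩

theorem ConfinedTo.mul {a b : ℕ} {g h : WreathProduct ZSq F} (hg : ConfinedTo a g)
    (hh : ConfinedTo b h) : ConfinedTo (a + b) (g * h) := by
  refine ⟨fun z hz => ?_, add_mem_square hg.2 hh.2⟩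
  change g.left.1 (Multiplicative.ofAdd z) *
    h.left.1 (Multiplicative.ofAdd (-g.right.toAdd + z)) ≠ 1 at hz
  by_cases h1 : g.left.1 (Multiplicative.ofAdd z) = 1
  · rw [h1, one_mul] at hz
    have := add_mem_square hg.2 (hh.1 _ hz)
    rwa [add_neg_cancel_left] at this
  · exact square_mono (Nat.le_add_right a b) (hg.1 z h1)

theorem exists_confinedTo (g : WreathProduct ZSq F) : ∃ a, ConfinedTo a g := by
  have hmem : ∀ z : ℤ × ℤ, z ∈ square (z.1.natAbs + z.2.natAbs) := by
    intro z
    simp only [square, Set.mem_ofPred_eq, abs_le]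
    push_cast
    have := abs_le.1 (le_refl |z.1|)
    have := abs_le.1 (le_refl |z.2|)
    have := abs_nonneg z.1
    have := abs_nonneg z.2
    omega
  have hfin : (Function.mulSupport g.left.1).Finite := g.left.2
  set t : Finset ZSq := insert g.right hfin.toFinset with ht
  refine ⟨t.sup fun z => z.toAdd.1.natAbs + z.toAdd.2.natAbs, fun z hz => ?_, ?_⟩
  · exact square_mono (Finset.le_sup (f := fun z : ZSq => z.toAdd.1.natAbs + z.toAdd.2.natAbs)
      (show Multiplicative.ofAdd z ∈ t by simp [ht, hz])) (hmem z)
  · exact square_mono (Finset.le_sup (f := fun z : ZSq => z.toAdd.1.natAbs + z.toAdd.2.natAbs)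
      (show g.right ∈ t by simp [ht])) (hmem _)

/-- The lamps and the position of an element lie in a square whose side is at most proportional
to the word length. -/
theorem exists_confinedTo_wordLength (S : Finset (WreathProduct ZSq F))
    (hS : Subgroup.closure (S : Set (WreathProduct ZSq F)) = ⊤) :
    ∃ C : ℕ, 0 < C ∧ ∀ g : WreathProduct ZSq F,
      ConfinedTo (C * wordLength (S : Set (WreathProduct ZSq F)) g) g ∧
        (wordLength (S : Set (WreathProduct ZSq F)) g = 0 → g = 1) := by
  choose a ha using exists_confinedTo (F := F)
  set C := S.sup (fun s => a s + a s⁻¹) + 1 with hC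
  have hC1 : ∀ s : WreathProduct ZSq F, s ∈ S ∨ s⁻¹ ∈ S → ConfinedTo C s := by
    rintro s (hs | hs)
    · have := Finset.le_sup (f := fun s => a s + a s⁻¹) hs
      exact (ha s).mono (by omega)
    · have := Finset.le_sup (f := fun s => a s + a s⁻¹) hs
      rw [inv_inv] at this
      exact (ha s).mono (by omega)
  have hlist : ∀ L : List (WreathProduct ZSq F), (∀ s ∈ L, s ∈ S ∨ s⁻¹ ∈ S) →
      ConfinedTo (C * L.length) L.prod := by
    intro L hL
    induction L with
    | nil => exact ⟨fun z hz => absurd rfl hz, by simp [square]⟩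
    | cons s L ih =>
      rw [List.prod_cons, List.length_cons, Nat.mul_succ, add_comm]
      exact (hC1 s (hL s (by simp))).mul (ih fun t ht => hL t (by simp [ht]))
  refine ⟨C, Nat.succ_pos _, fun g => ?_⟩
  obtain ⟨L, hL, hLg⟩ := Submonoid.exists_list_of_mem_closure
    (show g ∈ Submonoid.closure ((S : Set (WreathProduct ZSq F)) ∪ (S : Set _)⁻¹) by
      rw [← Subgroup.closure_toSubmonoid, hS]; trivial)
  obtain ⟨M, hM, hMg, hMl⟩ := Nat.sInf_mem (s := {k | ∃ v : List (WreathProduct ZSq F),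
    (∀ s ∈ v, s ∈ (S : Set (WreathProduct ZSq F)) ∨ s⁻¹ ∈ (S : Set (WreathProduct ZSq F))) ∧
      v.prod = g ∧ v.length = k}) ⟨_, L, hL, hLg, rfl⟩
  refine ⟨?_, fun h0 => ?_⟩
  · have := hlist M hM
    rw [hMg, hMl] at this
    exact this
  · rw [wordLength, ← hMl, List.length_eq_zero_iff] at h0
    rw [← hMg, h0, List.prod_nil]

end WordLength

/-! ### Individual almost invariance -/

open Classical in
/-- By symmetry of the walk, a right translate of its law is the law of the inverse of the walk
started at the translating element. -/
theorem toOuterMeasure_map_mul_inv_convPow {F : Type*} [Group F] [Fintype F]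
    {μ : PMF (WreathProduct ZSq F)} (hμ : IsStandardSwitchWalkSwitch μ)
    (hsupp : (projZSq μ).support = stepSet) (n : ℕ) (g : WreathProduct ZSq F)
    (W : Set (WreathProduct ZSq F)) :
    ((μ.convPow n).map (· * g⁻¹)).toOuterMeasure W =
      ENNReal.ofReal ((swsAvg fun s => (projZSq μ s).toReal)^[n]
        (fun h => if h⁻¹ ∈ W then 1 else 0) g) := by
  rw [← tsum_convPow_mul_eq_iterate_swsAvg hμ hsupp n
    (fun h => by split_ifs <;> norm_num) g]
  conv_lhs => rw [← PMF.map_inv_convPow (map_inv_of_isStandardSwitchWalkSwitch hμ) n, PMF.map_comp]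
  rw [PMF.toOuterMeasure_map_apply, PMF.toOuterMeasure_apply]
  refine tsum_congr fun h => ?_
  by_cases hh : h⁻¹ * g⁻¹ ∈ W <;> simp [Set.indicator, hh]

theorem mainTheorem5 {F : Type*} [Group F] [Fintype F] [Nontrivial F]
    (S : Finset (WreathProduct ZSq F)) (hS : Subgroup.closure (S : Set (WreathProduct ZSq F)) = ⊤)
    (μ : PMF (WreathProduct ZSq F)) (hμ : IsStandardSwitchWalkSwitch μ)
    (hsupp : (projZSq μ).support = {(0, 0), (1, 0), (-1, 0), (0, 1), (0, -1)})
    (r : ℕ → ℝ) (hr : IsCoveringRadius (projZSq μ) r) :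
    IndividualRadiusGE (S : Set (WreathProduct ZSq F)) μ r := by
  classical
  have hsupp' : (projZSq μ).support = stepSet := by rw [hsupp, stepSet]; push_cast; rfl
  have hw := isStepWeight_projZSq hμ hsupp'
  obtain ⟨C, hC, hword⟩ := exists_confinedTo_wordLength S hS
  intro r' hr' ε hε
  have hδ : 0 < ε ^ 2 / 2 := by positivity
  filter_upwards [eventually_abs_iterate_swsAvg_sub_le (F := F) hsupp' hw hr hr'
    (show (0 : ℝ) < C by exact_mod_cast hC) hδ] with n hn g hg
  have hdist : ∀ φ : WreathProduct ZSq F → ℝ, (∀ h, φ h ∈ Set.Icc 0 1) →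
      |(swsAvg fun s => (projZSq μ s).toReal)^[n] φ g -
        (swsAvg fun s => (projZSq μ s).toReal)^[n] φ 1| ≤ ε ^ 2 / 2 := by
    intro φ hφ
    obtain ⟨hconf, hone⟩ := hword g
    rcases Nat.eq_zero_or_pos (wordLength (S : Set (WreathProduct ZSq F)) g) with h0 | h0
    · rw [hone h0, sub_self, abs_zero]
      exact hδ.le
    · refine hn _ (Nat.mul_pos hC h0) ?_ g hconf φ hφ
      push_cast
      gcongr
  obtain ⟨V, hV1, hV2⟩ := exists_set_ratio_le (p := μ.convPow n)
    (q := (μ.convPow n).map (· * g⁻¹)) hε (δ := ε ^ 2 / 2) (by linarith) (fun W => by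
      have h0 : (μ.convPow n).map (· * (1 : WreathProduct ZSq F)⁻¹) = μ.convPow n := by
        simp only [inv_one, mul_one]
        exact PMF.map_id _
      have h1 := toOuterMeasure_map_mul_inv_convPow hμ hsupp' n 1 W
      rw [h0] at h1
      have hφ : ∀ h : WreathProduct ZSq F, (if h⁻¹ ∈ W then (1 : ℝ) else 0) ∈ Set.Icc 0 1 :=
        fun h => by split_ifs <;> simp
      rw [toOuterMeasure_map_mul_inv_convPow hμ hsupp', h1,
        ENNReal.toReal_ofReal (iterate_swsAvg_mem_Icc hw hφ n _).1,
        ENNReal.toReal_ofReal (iterate_swsAvg_mem_Icc hw hφ n _).1]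
      exact hdist _ hφ)
  refine ⟨V, hV1, fun h hh => ?_⟩
  have hq : (μ.convPow n).map (· * g⁻¹) h = μ.convPow n (h * g) := by
    rw [PMF.map_apply, tsum_eq_single (h * g)]
    · simp
    · intro b hb
      rw [if_neg]
      rintro rfl
      simp at hb
  rw [← hq]
  exact hV2 h hh
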